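/- **Theorem (Coconut–CIB duality).** *Setting.* Let $(X,S)$ be a random pair, where $X$ takes values in a measurable space and $S=(s_1,\dots,s_M)$ is a chain of $M$ steps from a countable set. Let $0\le k\le M$; write $S_-=S^{(1\dots k)}$ and $S_+=S^{(k+1\dots M)}$, and assume $H(S_+\mid X)<\infty$. A (stochastic) encoder is a conditional law $p(h_k\mid S_-,X)$ of a latent state $h_k\in\mathbb R^d$; thus $h_k$ and $S_+$ are conditionally independent given $(S_-,X)$. For an encoder $p$ put $H(p)=H(S_+\mid h_k,X)$, $I_-(p)=I(h_k;S_-\mid X)$ and $I_+(p)=I(h_k;S_+\mid X)$. A decoder is a conditional law $q(S_+\mid h_k,X)$; the stage-$k$ Coconut loss is $\mathcal L(p,q)=\mathbb E[-\log q(S_+\mid h_k,X)]$. For a capacity $R\ge 0$ the primal problem is to minimize $H(p)$ over all encoders with $I_-(p)\le R$; its value (infimum) is $v(R)$. Its Lagrangian is $J_R(p,\lambda)=H(p)+\lambda(I_-(p)-R)$ and its dual function is $g_R(\lambda)=\inf_p J_R(p,\lambda)$, $\lambda\ge0$. For $\beta>0$ the Conditional Information Bottleneck (CIB) problem is to minimize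 $C_\beta(p)=I_-(p)-\beta I_+(p)$ over all encoders. Call $\beta>0$ a *trade-off parameter* for $R$ if $g_R(1/\beta)=v(R)$, i.e. if $1/\beta$ is an optimal Lagrange multiplier with zero duality gap. Let $F(r)=\sup\{I_+(p): I_-(p)\le r\}$ be the efficiency frontier. 1. *Loss and primal problem.* $H(p)+I_+(p)=H(S_+\mid X)$ for every encoder. For all $p,q$, $\mathcal L(p,q)\ge H(p)$, with equality iff $q$ is almost everywhere the true conditional law of $S_+$ given $(h_k,X)$. Let $R\in[0,\infty]$ and let $\theta\mapsto(p_\theta,q_\theta)$ be a parametric family that is well-specified: for each encoder $p$ with $I_-(p)\le R$ there is $\theta$ with $p_\theta=p$ and $q_\theta$ almost everywhere the true conditional law. Then $\inf\{\mathcal L(p_\theta,q_\theta): I_-(p_\theta)\le R\}=v(R)$; a parameter $\theta$ minimizes the loss under $I_-(p_\theta)\le R$ iff $p_\theta$ solves the primal problem and $q_\theta$ is almost everywhere the true conditional law; and an encoder solves the primal problem iff it is $p_\theta$ for some such minimizer $\theta$. 2. *Dual problem.* Let $0\le R<\infty$. For every $\lambda>0$, $J_R(p,\lambda)=\lambda\,C_{1/\lambda}(p)+H(S_+\mid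 X)-\lambda R$ for all $p$; hence $g_R(\lambda)=\lambda\inf_pC_{1/\lambda}(p)+H(S_+\mid X)-\lambda R$, and the minimizers of $J_R(\cdot,\lambda)$ are those of $C_{1/\lambda}$. Strong duality holds and is attained: $v(R)=\max_{\lambda\ge0}g_R(\lambda)$. If the capacity binds, i.e. $\inf_pH(p)<v(R)$, a trade-off parameter $\beta>0$ exists. If $\beta$ is a trade-off parameter for $R$, an encoder solves the primal problem iff it solves the CIB problem with parameter $\beta$ and has $I_-=R$. Conversely, for every $\beta>0$, each solution $p$ of the CIB problem has $R:=I_-(p)<\infty$, solves the primal problem with capacity $R$, and $\beta$ is a trade-off parameter for $R$. 3. *First-order condition.* If $R>0$ and $F$ is differentiable at $R$, then $\beta>0$ is a trade-off parameter for $R$ iff $F'(R)=1/\beta$. 4. *Exponential frontier.* Let $R,I_{\max},\alpha>0$ and suppose that $F(r)=I_{\max}(1-e^{-\alpha r})$ for all $r\le R$ close to $R$. Then the least trade-off parameter for $R$ is $e^{\alpha R}/(I_{\max}\alpha)$; if the formula for $F$ holds on a two-sided neighbourhood of $R$, it is the only one. In particular, if $k<M$, $C_1,C_2>0$, $C_0\in\mathbb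 R$, $R=C_1k+C_0>0$, $I_{\max}=C_2(M-k)$ and $\alpha=1/(C_1k+C_0)$, the least trade-off parameter is $$\beta(k)=\frac{e\,(C_1k+C_0)}{C_2(M-k)},\qquad \Big|\beta(k)-\frac{eC_1}{C_2}\cdot\frac{k}{M-k}\Big|\le\frac{e|C_0|/C_2}{M-k}.$$ 5. *Asymptotics.* Consider a sequence of such problems (same input space, step set and $d$) with lengths $M_n$, stages $k_n<M_n$, $k_n\to\infty$, capacities $R_n>0$, and frontiers $F_n(r)=I_{\max,n}(1-e^{-\alpha_nr})$ for all $r\le R_n$ close to $R_n$, with $I_{\max,n},\alpha_n>0$. Let $C_1,C_2>0$, $C_0\in\mathbb R$. If $I_{\max,n}\sim C_2(M_n-k_n)$, $\alpha_n\sim1/(C_1k_n+C_0)$ and $R_n\sim1/\alpha_n$, then the least trade-off parameters $\beta_n$ satisfy $$\beta_n\sim\frac{eC_1}{C_2}\cdot\frac{k_n}{M_n-k_n}\qquad(n\to\infty).$$ -/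

import Mathlib

open MeasureTheory ProbabilityTheory InformationTheory Filter Topology Asymptotics
open scoped ENNReal NNReal

namespace CoconutCIB

noncomputable section

/-! ### Conditional entropy and conditional mutual information (in nats) -/

section Information

variable {Ω α β γ : Type*} [MeasurableSpace Ω] [MeasurableSpace α] [MeasurableSpace β]
  [MeasurableSpace γ]

/-- Shannon conditional entropy `H(A | C)` of a discrete random variable `A`: the average over the
law of `C` of the entropy of the conditional law of `A` given `C`, valued in `[0, ∞]`. -/
def condEntropy [Countable α] [MeasurableSingletonClass α] [Nonempty α]
    (A : Ω → α) (C : Ω → γ) (μ : Measure Ω) [IsFiniteMeasure μ] : ℝ≥0∞ :=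
  ∫⁻ c, ∑' a, ENNReal.ofReal (Real.negMulLog ((condDistrib A C μ c).real {a})) ∂(μ.map C)

/-- Conditional mutual information `I(A ; B | C)`: the relative entropy of the law of `(C, A, B)`
with respect to the law under which `A` and `B` are conditionally independent given `C` with the
same conditional marginals, valued in `[0, ∞]`. -/
def condMutualInfo [StandardBorelSpace α] [Nonempty α] [StandardBorelSpace β] [Nonempty β]
    (A : Ω → α) (B : Ω → β) (C : Ω → γ) (μ : Measure Ω) [IsFiniteMeasure μ] : ℝ≥0∞ :=
  klDiv (μ.map fun ω => (C ω, A ω, B ω))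
    ((μ.map C) ⊗ₘ (condDistrib A C μ ×ₖ condDistrib B C μ))

end Information

/-! ### Reasoning chains, encoders, decoders -/

/-- Latent states. -/
abbrev Latent (d : ℕ) : Type := EuclideanSpace ℝ (Fin d)

/-- Prefixes `S^(1..k)` of chains `(s_1, ..., s_M)`; the entry `i : Fin M` is the step `s_(i+1)`. -/
abbrev Past (𝒯 : Type*) (M k : ℕ) := {i : Fin M // (i : ℕ) < k} → 𝒯

/-- Suffixes `S^(k+1..M)`. -/
abbrev Future (𝒯 : Type*) (M k : ℕ) := {i : Fin M // k ≤ (i : ℕ)} → 𝒯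

/-- The prefix `S^(1..k)` of the chain `s`. -/
def past {𝒯 : Type*} {M : ℕ} (k : ℕ) (s : Fin M → 𝒯) : Past 𝒯 M k := fun i => s i

/-- The suffix `S^(k+1..M)` of the chain `s`. -/
def future {𝒯 : Type*} {M : ℕ} (k : ℕ) (s : Fin M → 𝒯) : Future 𝒯 M k := fun i => s i

lemma measurable_past {𝒯 : Type*} [MeasurableSpace 𝒯] {M : ℕ} (k : ℕ) :
    Measurable (past k : (Fin M → 𝒯) → Past 𝒯 M k) :=
  measurable_pi_lambda _ fun i => measurable_pi_apply i.1

/-- A stochastic stage-`k` encoder: the conditional law of the latent state `h_k` given the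
input and the prefix. -/
structure Encoder (𝒳 𝒯 : Type*) [MeasurableSpace 𝒳] [MeasurableSpace 𝒯] (M k d : ℕ) where
  kernel : Kernel (𝒳 × Past 𝒯 M k) (Latent d)
  isMarkov : IsMarkovKernel kernel

/-- A stage-`k` decoder: a conditional law of the suffix given the latent state and the input. -/
structure Decoder (𝒳 𝒯 : Type*) [MeasurableSpace 𝒳] [MeasurableSpace 𝒯] (M k d : ℕ) where
  kernel : Kernel (Latent d × 𝒳) (Future 𝒯 M k)
  isMarkov : IsMarkovKernel kernel

section Problem

variable {𝒳 𝒯 : Type*} [MeasurableSpace 𝒳] [MeasurableSpace 𝒯]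
  {M k d : ℕ}

/-- The encoder as a kernel on pairs (input, full chain); it only looks at the prefix. -/
def Encoder.onChain (κ : Encoder 𝒳 𝒯 M k d) : Kernel (𝒳 × (Fin M → 𝒯)) (Latent d) :=
  κ.kernel.comap (fun z => (z.1, past k z.2))
    (measurable_fst.prodMk ((measurable_past k).comp measurable_snd))

instance (κ : Encoder 𝒳 𝒯 M k d) : IsMarkovKernel κ.onChain := by
  have := κ.isMarkov
  unfold Encoder.onChain
  infer_instance

/-- The joint law of `((X, S), h_k)` when `(X, S)` has law `P` and `h_k` is produced by `κ`. -/
def jointLaw (P : Measure (𝒳 × (Fin M → 𝒯))) (κ : Encoder 𝒳 𝒯 M k d) :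
    Measure ((𝒳 × (Fin M → 𝒯)) × Latent d) :=
  P ⊗ₘ κ.onChain

instance (P : Measure (𝒳 × (Fin M → 𝒯))) [IsProbabilityMeasure P] (κ : Encoder 𝒳 𝒯 M k d) :
    IsProbabilityMeasure (jointLaw P κ) := by
  unfold jointLaw
  infer_instance

variable [Countable 𝒯] [MeasurableSingletonClass 𝒯] [Nonempty 𝒯]
  (P : Measure (𝒳 × (Fin M → 𝒯))) [IsProbabilityMeasure P]

/-- `H(S^(k+1..M) | X)`. -/
def futureEntropy (k : ℕ) : ℝ≥0∞ :=
  condEntropy (fun z : 𝒳 × (Fin M → 𝒯) => future k z.2) (fun z => z.1) P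

/-- `H(S^(k+1..M) | h_k, X)`. -/
def latentEntropy (κ : Encoder 𝒳 𝒯 M k d) : ℝ≥0∞ :=
  condEntropy (fun z : (𝒳 × (Fin M → 𝒯)) × Latent d => future k z.1.2)
    (fun z => (z.2, z.1.1)) (jointLaw P κ)

/-- `I(h_k ; S^(1..k) | X)`. -/
def infoPast (κ : Encoder 𝒳 𝒯 M k d) : ℝ≥0∞ :=
  condMutualInfo (fun z : (𝒳 × (Fin M → 𝒯)) × Latent d => z.2) (fun z => past k z.1.2)
    (fun z => z.1.1) (jointLaw P κ)

/-- `I(h_k ; S^(k+1..M) | X)`. -/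
def infoFuture (κ : Encoder 𝒳 𝒯 M k d) : ℝ≥0∞ :=
  condMutualInfo (fun z : (𝒳 × (Fin M → 𝒯)) × Latent d => z.2) (fun z => future k z.1.2)
    (fun z => z.1.1) (jointLaw P κ)

/-! ### The Coconut loss -/

/-- The stage-`k` Coconut loss `E[-log q(S^(k+1..M) | h_k, X)]` of an encoder and a decoder `q`,
valued in `[0, ∞]` (with `-log 0 = ∞`). -/
def loss (κ : Encoder 𝒳 𝒯 M k d) (q : Decoder 𝒳 𝒯 M k d) : ℝ≥0∞ :=
  ∫⁻ z, (-(ENNReal.log (q.kernel (z.2, z.1.1) {future k z.1.2}))).toENNReal ∂(jointLaw P κ)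

/-- The decoder `q` is almost everywhere the true conditional law of the suffix given `(h_k, X)`,
when `h_k` is produced by `κ`. -/
def IsPosterior (κ : Encoder 𝒳 𝒯 M k d) (q : Decoder 𝒳 𝒯 M k d) : Prop :=
  ∀ᵐ y ∂((jointLaw P κ).map fun z => (z.2, z.1.1)),
    q.kernel y = condDistrib (fun z : (𝒳 × (Fin M → 𝒯)) × Latent d => future k z.1.2)
      (fun z => (z.2, z.1.1)) (jointLaw P κ) y

/-- The parametric model `θ ↦ (encoder, decoder)` is well-specified at capacity `R`: every encoder
within the capacity is realized by some parameter whose decoder is the true conditional law of the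
suffix almost everywhere. -/
def WellSpecified {Θ : Type*} (enc : Θ → Encoder 𝒳 𝒯 M k d) (dec : Θ → Decoder 𝒳 𝒯 M k d)
    (R : ℝ≥0∞) : Prop :=
  ∀ κ : Encoder 𝒳 𝒯 M k d, infoPast P κ ≤ R → ∃ θ, enc θ = κ ∧ IsPosterior P κ (dec θ)

/-- `θ` minimizes the Coconut loss among the parameters whose encoder has capacity at most `R`. -/
def IsLossSolution {Θ : Type*} (enc : Θ → Encoder 𝒳 𝒯 M k d) (dec : Θ → Decoder 𝒳 𝒯 M k d)
    (R : ℝ≥0∞) (θ : Θ) : Prop :=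
  infoPast P (enc θ) ≤ R ∧
    ∀ θ', infoPast P (enc θ') ≤ R → loss P (enc θ) (dec θ) ≤ loss P (enc θ') (dec θ')

/-! ### Primal problem, Lagrangian, dual problem, Conditional Information Bottleneck -/

/-- Value of the primal problem: the infimum of `H(S^(k+1..M) | h_k, X)` subject to
`I(h_k ; S^(1..k) | X) ≤ R`. -/
def primalValue (k d : ℕ) (R : ℝ≥0∞) : ℝ≥0∞ :=
  ⨅ κ : Encoder 𝒳 𝒯 M k d, ⨅ _ : infoPast P κ ≤ R, latentEntropy P κ

/-- `κ` solves the primal problem. -/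
def IsPrimalSolution (R : ℝ≥0∞) (κ : Encoder 𝒳 𝒯 M k d) : Prop :=
  infoPast P κ ≤ R ∧
    ∀ κ' : Encoder 𝒳 𝒯 M k d, infoPast P κ' ≤ R → latentEntropy P κ ≤ latentEntropy P κ'

/-- The Lagrangian `H(S^(k+1..M) | h_k, X) + l * (I(h_k ; S^(1..k) | X) - R)`. -/
def lagrangian (R : ℝ≥0) (l : ℝ) (κ : Encoder 𝒳 𝒯 M k d) : EReal :=
  (latentEntropy P κ : EReal) + (l : EReal) * ((infoPast P κ : EReal) - ((R : ℝ) : EReal))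

/-- The Lagrange dual function. -/
def dualFunction (k d : ℕ) (R : ℝ≥0) (l : ℝ) : EReal :=
  ⨅ κ : Encoder 𝒳 𝒯 M k d, lagrangian P R l κ

/-- The CIB objective `I(h_k ; S^(1..k) | X) - b * I(h_k ; S^(k+1..M) | X)`. -/
def cibObjective (b : ℝ) (κ : Encoder 𝒳 𝒯 M k d) : EReal :=
  (infoPast P κ : EReal) - (b : EReal) * (infoFuture P κ : EReal)

/-- `κ` solves the CIB problem with trade-off `b`. -/
def IsCIBSolution (b : ℝ) (κ : Encoder 𝒳 𝒯 M k d) : Prop :=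
  ∀ κ' : Encoder 𝒳 𝒯 M k d, cibObjective P b κ ≤ cibObjective P b κ'

/-- `b > 0` is a trade-off parameter for the capacity `R`: its inverse `1 / b` is an optimal
Lagrange multiplier of the primal problem, without duality gap. -/
def IsTradeoff (k d : ℕ) (R : ℝ≥0) (b : ℝ) : Prop :=
  0 < b ∧ dualFunction P k d R b⁻¹ = (primalValue P k d R : EReal)

/-- The efficiency frontier of the information plane: the largest `I(h_k ; S^(k+1..M) | X)`
compatible with `I(h_k ; S^(1..k) | X) ≤ r`. -/
def efficiencyFrontier (k d : ℕ) (r : ℝ) : ℝ :=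
  (⨆ κ : Encoder 𝒳 𝒯 M k d, ⨆ _ : infoPast P κ ≤ ENNReal.ofReal r, infoFuture P κ).toReal

/-- The exponential frontier model `I_max * (1 - exp(-a * r))`. -/
def expFrontier (Imax a r : ℝ) : ℝ := Imax * (1 - Real.exp (-(a * r)))

end Problem

end

end CoconutCIB

open CoconutCIB

/-! Everything reduces to the concave frontier `F`. The chain rule `condEntropy_add_condMutualInfo`
gives `H + I_+ = H(S_+ | X) < ∞`, so minimizing `H` is maximizing `I_+`, the primal value is `H(S_+
| X) - F(R)`, and the Lagrangian is an increasing affine function of the CIB objective. The excess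
of the loss over `H` is an expected relative entropy, which settles the loss.

`F` is concave by time sharing (`infoAbout_mixEncoder`): a bit telling which of two encoders was
used is stored in the latent state through a Borel isomorphism `Bool × ℝ^d ≃ ℝ^d`, and both
informations then average exactly.

A multiplier `l ≥ 0` closes the duality gap iff it is a supergradient of `F` at `R`
(`dualFunction_eq_primalValue_iff`). For `R > 0` a concave function has one. At `R = 0` data
processing gives `F(r) ≤ r`, so `l = 1` works. For `l = 0` the Lagrangian ignores the capacity, and
encoders with `I_- = ∞` must be approximated by truncated ones (`exists_infoPast_ne_top`). Solutions
correspond by complementary slackness. Since the left derivative is the largest supergradient, its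
inverse is the least trade-off parameter, and the exponential formulas follow by differentiation. -/

namespace CoconutCIB

/-! ### Relative entropy on countable spaces -/

/-- The code length `-log q`, with `-log 0 = ∞`. -/
noncomputable def codeLength (q : ℝ≥0∞) : ℝ≥0∞ := (-(ENNReal.log q)).toENNReal

/-- The contribution `p log (p / q) + q - p` of an atom to a relative entropy. -/
noncomputable def klTerm (p q : ℝ≥0∞) : ℝ≥0∞ :=
  if q = 0 then (if p = 0 then 0 else ⊤) else q * ENNReal.ofReal (klFun (p / q).toReal)

lemma measurable_codeLength : Measurable codeLength := by
  unfold codeLength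
  exact (ENNReal.measurable_log.neg).ereal_toENNReal

lemma measurable_klTerm : Measurable (Function.uncurry klTerm) := by
  unfold klTerm Function.uncurry
  refine Measurable.ite (measurable_snd (measurableSet_singleton 0))
    (Measurable.ite (measurable_fst (measurableSet_singleton 0)) measurable_const measurable_const)
    ?_
  fun_prop

lemma codeLength_zero : codeLength 0 = ⊤ := by simp [codeLength]

lemma codeLength_of_pos {q : ℝ≥0∞} (h0 : q ≠ 0) (h1 : q ≠ ⊤) :
    codeLength q = ENNReal.ofReal (-Real.log q.toReal) := by
  rw [codeLength, ENNReal.log_pos_real h0 h1, ← EReal.coe_neg, EReal.toENNReal_of_ne_top]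
  · simp
  · simp

/-- Pointwise decomposition of a cross entropy into an entropy and a relative entropy. -/
lemma negMulLog_add_klTerm {p q : ℝ≥0∞} (hp : p ≤ 1) (hq : q ≤ 1) :
    ENNReal.ofReal (Real.negMulLog p.toReal) + p + klTerm p q = p * codeLength q + q := by
  have hp' : p ≠ ⊤ := ne_top_of_le_ne_top ENNReal.one_ne_top hp
  have hq' : q ≠ ⊤ := ne_top_of_le_ne_top ENNReal.one_ne_top hq
  have hp1 : p.toReal ≤ 1 := ENNReal.toReal_mono ENNReal.one_ne_top hp
  have hq1 : q.toReal ≤ 1 := ENNReal.toReal_mono ENNReal.one_ne_top hq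
  by_cases hq0 : q = 0
  · by_cases hp0 : p = 0
    · simp [hq0, hp0, klTerm]
    · simp [hq0, hp0, klTerm, codeLength_zero, ENNReal.mul_top]
  have hqpos : 0 < q.toReal := ENNReal.toReal_pos hq0 hq'
  have hpn : 0 ≤ p.toReal := ENNReal.toReal_nonneg
  rw [klTerm, if_neg hq0, codeLength_of_pos hq0 hq']
  have h1 : 0 ≤ Real.negMulLog p.toReal := Real.negMulLog_nonneg hpn hp1
  have h2 : 0 ≤ klFun (p / q).toReal := klFun_nonneg ENNReal.toReal_nonneg
  have h3 : 0 ≤ -Real.log q.toReal := neg_nonneg.2 (Real.log_nonpos hqpos.le hq1)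
  conv_lhs => rw [← ENNReal.ofReal_toReal hp', ← ENNReal.ofReal_toReal hq']
  conv_rhs => rw [← ENNReal.ofReal_toReal hp', ← ENNReal.ofReal_toReal hq']
  simp only [ENNReal.toReal_ofReal, hpn, hqpos.le]
  rw [← ENNReal.ofReal_div_of_pos hqpos, ENNReal.toReal_ofReal (by positivity)]
  rw [ENNReal.toReal_div] at h2
  rw [← ENNReal.ofReal_mul hqpos.le, ← ENNReal.ofReal_mul hpn, ← ENNReal.ofReal_add h1 hpn,
    ← ENNReal.ofReal_add (by positivity) (by positivity),
    ← ENNReal.ofReal_add (by positivity) (by positivity)]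
  congr 1
  rcases hpn.eq_or_lt with h | h
  · rw [← h]; simp [klFun_zero]
  · rw [klFun_apply, Real.negMulLog, Real.log_div h.ne' hqpos.ne']
    field_simp
    ring

lemma klTerm_eq_zero_iff {p q : ℝ≥0∞} (hp : p ≤ 1) (hq : q ≤ 1) : klTerm p q = 0 ↔ p = q := by
  have hp' : p ≠ ⊤ := ne_top_of_le_ne_top ENNReal.one_ne_top hp
  have hq' : q ≠ ⊤ := ne_top_of_le_ne_top ENNReal.one_ne_top hq
  unfold klTerm
  split_ifs with h1 h2
  · simp [h1, h2]
  · simp [h1, h2]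
  · have h3 := klFun_eq_zero_iff (x := (p / q).toReal) ENNReal.toReal_nonneg
    have h4 := klFun_nonneg (x := (p / q).toReal) ENNReal.toReal_nonneg
    rw [mul_eq_zero, or_iff_right h1, ENNReal.ofReal_eq_zero, h4.ge_iff_eq', h3,
      ENNReal.toReal_eq_one_iff, ENNReal.div_eq_one_iff h1 hq']

section Countable

variable {β : Type*} [MeasurableSpace β] [Countable β] [MeasurableSingletonClass β]

/-- Relative entropy of probability measures on a countable space. -/
noncomputable def discreteKL (μ ν : Measure β) : ℝ≥0∞ := ∑' b, klTerm (μ {b}) (ν {b})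

/-- Cross entropy of probability measures on a countable space. -/
noncomputable def crossEntropy (μ ν : Measure β) : ℝ≥0∞ := ∑' b, μ {b} * codeLength (ν {b})

lemma tsum_measure_singleton (μ : Measure β) : ∑' b, μ {b} = μ Set.univ := by
  rw [← lintegral_one, lintegral_countable']
  simp

lemma crossEntropy_eq_lintegral (μ ν : Measure β) :
    crossEntropy μ ν = ∫⁻ b, codeLength (ν {b}) ∂μ := by
  rw [lintegral_countable', crossEntropy]
  simp_rw [mul_comm]

/-- The corrections `q - p` inside `klTerm` sum to zero because both measures have mass one. The
termwise identity keeps `p` and `q` on opposite sides, so nothing is subtracted in `ℝ≥0∞`. -/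
lemma entropy_add_discreteKL (μ ν : Measure β) [IsProbabilityMeasure μ] [IsProbabilityMeasure ν] :
    ∑' b, ENNReal.ofReal (Real.negMulLog (μ.real {b})) + discreteKL μ ν = crossEntropy μ ν := by
  have h : ∑' b, (ENNReal.ofReal (Real.negMulLog (μ.real {b})) + μ {b} + klTerm (μ {b}) (ν {b}))
      = ∑' b, (μ {b} * codeLength (ν {b}) + ν {b}) :=
    tsum_congr fun b => negMulLog_add_klTerm prob_le_one prob_le_one
  rw [ENNReal.tsum_add, ENNReal.tsum_add, ENNReal.tsum_add, tsum_measure_singleton,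
    tsum_measure_singleton, measure_univ, measure_univ, add_right_comm] at h
  exact (ENNReal.add_left_inj ENNReal.one_ne_top).1 h

omit [MeasurableSingletonClass β] in
lemma discreteKL_eq_zero_iff (μ ν : Measure β) [IsProbabilityMeasure μ] [IsProbabilityMeasure ν] :
    discreteKL μ ν = 0 ↔ μ = ν := by
  rw [discreteKL, ENNReal.tsum_eq_zero, Measure.ext_iff_singleton]
  exact forall_congr' fun b => klTerm_eq_zero_iff prob_le_one prob_le_one

variable {α : Type*} [MeasurableSpace α]

lemma measurable_discreteKL (κ η : Kernel α β) : Measurable fun x => discreteKL (κ x) (η x) := by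
  refine Measurable.tsum fun b => ?_
  exact measurable_klTerm.comp ((κ.measurable_coe (measurableSet_singleton b)).prodMk
    (η.measurable_coe (measurableSet_singleton b)))

/-- Relative entropy of composition-products over a common base, with countable target. -/
lemma klDiv_compProd_eq_lintegral_discreteKL (μ : Measure α) [IsFiniteMeasure μ]
    (κ η : Kernel α β) [IsMarkovKernel κ] [IsMarkovKernel η]
    (h : ∀ᵐ x ∂μ, ∀ b, η x {b} = 0 → κ x {b} = 0) :
    klDiv (μ ⊗ₘ κ) (μ ⊗ₘ η) = ∫⁻ x, discreteKL (κ x) (η x) ∂μ := by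
  set f : α × β → ℝ≥0∞ := fun z => κ z.1 {z.2} / η z.1 {z.2} with hf
  have hfm : Measurable f := by
    refine measurable_from_prod_countable_left fun b => ?_
    exact (κ.measurable_coe (measurableSet_singleton b)).div
      (η.measurable_coe (measurableSet_singleton b))
  -- The quotient of atom masses is a density: where the denominator vanishes, `h` makes the
  -- numerator vanish too.
  have hd : μ ⊗ₘ κ = (μ ⊗ₘ η).withDensity f := by
    ext s hs
    rw [withDensity_apply _ hs, ← lintegral_indicator hs,
      Measure.lintegral_compProd (hfm.indicator hs), ← lintegral_indicator_one hs,
      Measure.lintegral_compProd (measurable_one.indicator hs)]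
    refine lintegral_congr_ae ?_
    filter_upwards [h] with x hx
    rw [lintegral_countable', lintegral_countable']
    refine tsum_congr fun b => ?_
    by_cases hb : (x, b) ∈ s
    · simp only [Set.indicator_of_mem hb, hf, Pi.one_apply, one_mul]
      rw [ENNReal.div_mul_cancel']
      · exact hx b
      · simp
    · simp [Set.indicator_of_notMem hb]
  have hac : μ ⊗ₘ κ ≪ μ ⊗ₘ η := hd ▸ withDensity_absolutelyContinuous _ _
  have hrn : (μ ⊗ₘ κ).rnDeriv (μ ⊗ₘ η) =ᵐ[μ ⊗ₘ η] f := by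
    rw [hd]; exact Measure.rnDeriv_withDensity _ hfm
  rw [klDiv_eq_lintegral_klFun_of_ac hac, lintegral_congr_ae (g := fun z =>
      ENNReal.ofReal (klFun (f z).toReal)) (by filter_upwards [hrn] with z hz; rw [hz]),
    Measure.lintegral_compProd (by fun_prop)]
  refine lintegral_congr_ae ?_
  filter_upwards [h] with x hx
  rw [lintegral_countable', discreteKL]
  refine tsum_congr fun b => ?_
  unfold klTerm
  split_ifs with h1 h2
  · simp [h1]
  · exact absurd (hx b h1) h2
  · rw [mul_comm]

end Countable

/-! ### Conditional entropy, conditional mutual information, code lengths -/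

section Information

variable {Ω α β γ : Type*} [MeasurableSpace Ω] [MeasurableSpace α] [MeasurableSpace β]
  [MeasurableSpace γ]

/-- Data processing applies to `g` and then to its left inverse `r`, giving the two inequalities. -/
lemma klDiv_map_of_leftInverse (μ ν : Measure α) [IsFiniteMeasure μ] [IsFiniteMeasure ν]
    {g : α → β} {r : β → α} (hg : Measurable g) (hr : Measurable r)
    (hrg : Function.LeftInverse r g) : klDiv (μ.map g) (ν.map g) = klDiv μ ν := by
  refine le_antisymm (klDiv_map_le μ ν hg) ?_
  have h := klDiv_map_le (μ.map g) (ν.map g) hr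
  rwa [Measure.map_map hr hg, Measure.map_map hr hg, hrg.comp_eq_id, Measure.map_id,
    Measure.map_id] at h

/-- The conditional mutual information as the divergence of the law of `((A, C), B)` from the law
under which `B` is drawn from its conditional law given `C` only. -/
lemma condMutualInfo_eq_klDiv [StandardBorelSpace α] [Nonempty α] [StandardBorelSpace β]
    [Nonempty β] {A : Ω → α} {B : Ω → β} {C : Ω → γ} {μ : Measure Ω} [IsFiniteMeasure μ]
    (hA : Measurable A) (hB : Measurable B) (hC : Measurable C) :
    condMutualInfo A B C μ = klDiv (μ.map fun ω => ((A ω, C ω), B ω))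
      ((μ.map fun ω => (A ω, C ω)) ⊗ₘ (condDistrib B C μ).prodMkLeft α) := by
  have hg : Measurable fun z : γ × α × β => ((z.2.1, z.1), z.2.2) := by fun_prop
  have hr : Measurable fun z : (α × γ) × β => (z.1.2, z.1.1, z.2) := by fun_prop
  rw [condMutualInfo, ← klDiv_map_of_leftInverse _ _ hg hr (fun _ => rfl),
    Measure.map_map hg (by fun_prop)]
  congr 1
  have h : (μ.map fun ω => (A ω, C ω)) = ((μ.map C) ⊗ₘ condDistrib A C μ).map Prod.swap := by
    rw [compProd_map_condDistrib hA.aemeasurable, Measure.map_map measurable_swap (by fun_prop)]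
    rfl
  refine Measure.ext_of_lintegral _ fun F hF => ?_
  rw [h, lintegral_map hF hg, Measure.lintegral_compProd (by fun_prop),
    Measure.lintegral_compProd hF]
  have h2 : Measurable fun z : α × γ => ∫⁻ b, F (z, b) ∂(condDistrib B C μ z.2) :=
    Measurable.lintegral_kernel_prod_right'
      (κ := (condDistrib B C μ).prodMkLeft α) (f := F) hF
  simp only [Kernel.prodMkLeft_apply]
  rw [lintegral_map h2 measurable_swap, Measure.lintegral_compProd
    (f := fun a : γ × α => ∫⁻ b, F (a.swap, b) ∂(condDistrib B C μ a.swap.2))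
    (h2.comp measurable_swap)]
  refine lintegral_congr fun c => ?_
  rw [Kernel.prod_apply, lintegral_prod _ (by fun_prop)]
  rfl

section Countable

variable [Countable β] [MeasurableSingletonClass β] [Nonempty β]
  {B : Ω → β} {μ : Measure Ω} [IsFiniteMeasure μ]

/-- Expected code lengths decompose into a conditional entropy and a relative entropy. -/
lemma condEntropy_add_lintegral_discreteKL {Z : Ω → γ} (hB : Measurable B) (hZ : Measurable Z)
    (η : Kernel γ β) [IsMarkovKernel η] :
    condEntropy B Z μ + ∫⁻ z, discreteKL (condDistrib B Z μ z) (η z) ∂(μ.map Z) =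
      ∫⁻ ω, codeLength (η (Z ω) {B ω}) ∂μ := by
  have hm : Measurable fun z : γ × β => codeLength (η z.1 {z.2}) :=
    measurable_codeLength.comp (measurable_from_prod_countable_left fun b =>
      η.measurable_coe (measurableSet_singleton b))
  rw [condEntropy, ← lintegral_add_right _ (measurable_discreteKL _ _)]
  simp_rw [entropy_add_discreteKL, crossEntropy_eq_lintegral]
  rw [← Measure.lintegral_compProd (f := fun z : γ × β => codeLength (η z.1 {z.2})) hm,
    compProd_map_condDistrib hB.aemeasurable, lintegral_map hm (by fun_prop)]

/-- Coding with the true conditional law makes the relative entropy vanish. The entropy becomes an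
integral over `Ω`, where coarser and finer conditioning can be compared. -/
lemma condEntropy_eq_lintegral_codeLength {Z : Ω → γ} (hB : Measurable B) (hZ : Measurable Z) :
    condEntropy B Z μ = ∫⁻ ω, codeLength (condDistrib B Z μ (Z ω) {B ω}) ∂μ := by
  rw [← condEntropy_add_lintegral_discreteKL hB hZ]
  simp [(discreteKL_eq_zero_iff _ _).2]

/-- Supplies the domination required by `klDiv_compProd_eq_lintegral_discreteKL`. On the
`C`-measurable event where `b` has conditional probability zero, `B = b` has probability zero;
disintegrating this along `(A, C)` gives a nonnegative function with zero integral. -/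
lemma condDistrib_singleton_eq_zero_of_coarser {A : Ω → α} {C : Ω → γ} (hA : Measurable A)
    (hB : Measurable B) (hC : Measurable C) :
    ∀ᵐ y ∂(μ.map fun ω => (A ω, C ω)), ∀ b, condDistrib B C μ y.2 {b} = 0 →
      condDistrib B (fun ω => (A ω, C ω)) μ y {b} = 0 := by
  rw [ae_all_iff]
  intro b
  set N : Set γ := {c | condDistrib B C μ c {b} = 0} with hN
  have hNm : MeasurableSet N :=
    (Kernel.measurable_coe _ (measurableSet_singleton b)) (measurableSet_singleton 0)
  have hAC : Measurable fun ω => (A ω, C ω) := by fun_prop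
  have h1 : μ (C ⁻¹' N ∩ B ⁻¹' {b}) = 0 := by
    rw [← setLIntegral_preimage_condDistrib hC hB.aemeasurable (measurableSet_singleton b) hNm]
    exact setLIntegral_eq_zero (hC hNm) fun ω hω => hω
  have h2 : ∫⁻ y in Prod.snd ⁻¹' N, condDistrib B (fun ω => (A ω, C ω)) μ y {b}
      ∂(μ.map fun ω => (A ω, C ω)) = 0 := by
    rw [setLIntegral_map (measurable_snd hNm)
      (Kernel.measurable_coe _ (measurableSet_singleton b)) hAC,
      setLIntegral_preimage_condDistrib hAC hB.aemeasurable (measurableSet_singleton b)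
        (measurable_snd hNm)]
    exact h1
  rw [setLIntegral_eq_zero_iff (measurable_snd hNm)
    (Kernel.measurable_coe _ (measurableSet_singleton b))] at h2
  exact h2

/-- **Chain rule**: conditioning on `A` in addition to `C` lowers the entropy of `B` by the
conditional mutual information. -/
lemma condEntropy_add_condMutualInfo [StandardBorelSpace α] [Nonempty α] {A : Ω → α} {C : Ω → γ}
    (hA : Measurable A) (hB : Measurable B) (hC : Measurable C) :
    condEntropy B (fun ω => (A ω, C ω)) μ + condMutualInfo A B C μ = condEntropy B C μ := by
  have hAC : Measurable fun ω => (A ω, C ω) := by fun_prop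
  have h : (μ.map fun ω => ((A ω, C ω), B ω)) = (μ.map fun ω => (A ω, C ω)) ⊗ₘ
      condDistrib B (fun ω => (A ω, C ω)) μ :=
    (compProd_map_condDistrib hB.aemeasurable).symm
  -- Code `B` by its law given `C` alone: the total cost is `H(B | C)`, and the excess over `H(B |
  -- A, C)` is the mutual information.
  rw [condMutualInfo_eq_klDiv hA hB hC, h, klDiv_compProd_eq_lintegral_discreteKL _ _ _
    (condDistrib_singleton_eq_zero_of_coarser hA hB hC), condEntropy_add_lintegral_discreteKL hB hAC,
    condEntropy_eq_lintegral_codeLength hB hC]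
  rfl

end Countable

/-- Conditional entropies of variables with finitely many values are finite. -/
lemma condEntropy_ne_top_of_finite [Finite β] [MeasurableSingletonClass β] [Nonempty β]
    (B : Ω → β) (Z : Ω → γ) (μ : Measure Ω) [IsFiniteMeasure μ] : condEntropy B Z μ ≠ ⊤ := by
  have := Fintype.ofFinite β
  have h : ∀ z, ∑' b, ENNReal.ofReal (Real.negMulLog ((condDistrib B Z μ z).real {b})) ≤
      Fintype.card β := fun z => by
    rw [tsum_fintype]
    refine (Finset.sum_le_card_nsmul _ _ 1 fun b _ => ?_).trans (by simp)
    rw [ENNReal.ofReal_le_one]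
    -- From `1 - 1/x ≤ log x` follows `-x log x ≤ 1 - x ≤ 1`, so each atom contributes at most one.
    have h1 := Real.one_sub_inv_le_log_of_pos
      (x := (condDistrib B Z μ z).real {b})
    have h2 : 0 ≤ (condDistrib B Z μ z).real {b} := measureReal_nonneg
    rcases h2.eq_or_lt with h0 | h0
    · simp [← h0]
    · have h3 := mul_le_mul_of_nonneg_left (h1 h0) h2
      rw [mul_sub, mul_inv_cancel₀ h0.ne'] at h3
      rw [Real.negMulLog]
      linarith
  refine ne_top_of_le_ne_top ?_ (lintegral_mono h)
  rw [lintegral_const]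
  finiteness

/-- The relative entropy is additive over a measurable partition into two sets. -/
lemma klDiv_eq_klDiv_restrict_add (μ ν : Measure α) [IsFiniteMeasure μ] [IsFiniteMeasure ν]
    {s : Set α} (hs : MeasurableSet s) :
    klDiv μ ν = klDiv (μ.restrict s) (ν.restrict s) + klDiv (μ.restrict sᶜ) (ν.restrict sᶜ) := by
  by_cases h : μ ≪ ν
  -- Restricting both measures to `t` does not change the Radon–Nikodym derivative on `t`.
  · have key : ∀ t : Set α, MeasurableSet t → klDiv (μ.restrict t) (ν.restrict t) =
        ∫⁻ x in t, ENNReal.ofReal (klFun (μ.rnDeriv ν x).toReal) ∂ν := fun t ht => by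
      rw [klDiv_eq_lintegral_klFun_of_ac (h.restrict t)]
      refine lintegral_congr_ae ?_
      have h1 : μ.restrict t = (ν.restrict t).withDensity (μ.rnDeriv ν) := by
        rw [← restrict_withDensity ht, Measure.withDensity_rnDeriv_eq _ _ h]
      have h2 : (μ.restrict t).rnDeriv (ν.restrict t) =ᵐ[ν.restrict t] μ.rnDeriv ν := by
        conv_lhs => rw [h1]
        exact Measure.rnDeriv_withDensity _ (Measure.measurable_rnDeriv _ _)
      filter_upwards [h2] with x hx
      rw [hx]
    rw [key s hs, key sᶜ hs.compl, klDiv_eq_lintegral_klFun_of_ac h, lintegral_add_compl _ hs]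
  -- A failure of absolute continuity is inherited by one of the two pieces, so both sides are
  -- infinite.
  · have h3 : ¬ (μ.restrict s ≪ ν.restrict s ∧ μ.restrict sᶜ ≪ ν.restrict sᶜ) := fun h4 => h <| by
      intro t ht
      have e : ∀ u : Set α, MeasurableSet u → μ.restrict u ≪ ν.restrict u → μ (t ∩ u) = 0 :=
        fun u hu hac => by
          have := hac (s := t) (by
            rw [Measure.restrict_apply' hu]; exact measure_mono_null Set.inter_subset_left ht)
          rwa [Measure.restrict_apply' hu] at this
      rw [← measure_inter_add_sdiff t hs, e s hs h4.1, Set.sdiff_eq, e sᶜ hs.compl h4.2, add_zero]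
    rw [klDiv_of_not_ac h]
    by_cases h5 : μ.restrict s ≪ ν.restrict s
    · rw [klDiv_of_not_ac (fun h6 => h3 ⟨h5, h6⟩), add_top]
    · rw [klDiv_of_not_ac h5, top_add]

end Information

/-! ### Information carried by an encoder about a function of the chain -/

section Encoders

variable {𝒳 𝒯 : Type*} [MeasurableSpace 𝒳] [MeasurableSpace 𝒯] {M k d : ℕ}
  {β γ : Type*} [MeasurableSpace β] [MeasurableSpace γ]

lemma measurable_future (k : ℕ) : Measurable (future k : (Fin M → 𝒯) → Future 𝒯 M k) :=
  measurable_pi_lambda _ fun i => measurable_pi_apply i.1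

lemma lintegral_jointLaw (P : Measure (𝒳 × (Fin M → 𝒯))) [IsProbabilityMeasure P]
    (κ : Encoder 𝒳 𝒯 M k d) {F : (𝒳 × (Fin M → 𝒯)) × Latent d → ℝ≥0∞} (hF : Measurable F) :
    ∫⁻ z, F z ∂(jointLaw P κ) = ∫⁻ y, ∫⁻ h, F (y, h) ∂(κ.kernel (y.1, past k y.2)) ∂P := by
  rw [jointLaw, Measure.lintegral_compProd hF]
  rfl

lemma map_fst_jointLaw (P : Measure (𝒳 × (Fin M → 𝒯))) [IsProbabilityMeasure P]
    (κ : Encoder 𝒳 𝒯 M k d) : (jointLaw P κ).map Prod.fst = P := by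
  rw [jointLaw]
  exact Measure.fst_compProd _ _

lemma map_input_jointLaw (P : Measure (𝒳 × (Fin M → 𝒯))) [IsProbabilityMeasure P]
    (κ : Encoder 𝒳 𝒯 M k d) : (jointLaw P κ).map (fun z => z.1.1) = P.map fun y => y.1 := by
  conv_rhs => rw [← map_fst_jointLaw P κ]
  rw [Measure.map_map (by fun_prop) (by fun_prop)]
  rfl

variable (P : Measure (𝒳 × (Fin M → 𝒯))) [IsProbabilityMeasure P]

/-- The joint law of `((h_k, X), f(S))`. -/
noncomputable def observationLaw (κ : Encoder 𝒳 𝒯 M k d) (f : (Fin M → 𝒯) → β) :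
    Measure ((Latent d × 𝒳) × β) :=
  (jointLaw P κ).map fun z => ((z.2, z.1.1), f z.1.2)

instance (κ : Encoder 𝒳 𝒯 M k d) (f : (Fin M → 𝒯) → β) :
    IsFiniteMeasure (observationLaw P κ f) := by
  unfold observationLaw; infer_instance

lemma lintegral_observationLaw (κ : Encoder 𝒳 𝒯 M k d) {f : (Fin M → 𝒯) → β} (hf : Measurable f)
    {F : (Latent d × 𝒳) × β → ℝ≥0∞} (hF : Measurable F) :
    ∫⁻ w, F w ∂(observationLaw P κ f) =
      ∫⁻ y, ∫⁻ h, F ((h, y.1), f y.2) ∂(κ.kernel (y.1, past k y.2)) ∂P := by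
  rw [observationLaw, lintegral_map hF (by fun_prop), lintegral_jointLaw P κ (by fun_prop)]

section StandardBorel

variable [StandardBorelSpace β] [Nonempty β] [StandardBorelSpace γ] [Nonempty γ]

/-- The conditional law given the input of a function of the chain does not depend on the
encoder. -/
lemma condDistrib_jointLaw_ae_eq (κ : Encoder 𝒳 𝒯 M k d) {f : (Fin M → 𝒯) → β}
    (hf : Measurable f) :
    condDistrib (fun z : (𝒳 × (Fin M → 𝒯)) × Latent d => f z.1.2) (fun z => z.1.1)
      (jointLaw P κ) =ᵐ[P.map fun y => y.1] condDistrib (fun y => f y.2) (fun y => y.1) P := by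
  rw [← map_input_jointLaw P κ]
  refine condDistrib_ae_eq_of_measure_eq_compProd _ (by fun_prop) ?_
  rw [map_input_jointLaw, compProd_map_condDistrib (by fun_prop)]
  conv_rhs => rw [← map_fst_jointLaw P κ]
  rw [Measure.map_map (by fun_prop) (by fun_prop)]
  rfl

/-- The mutual information `I(h_k ; f(S) | X)`. -/
noncomputable def infoAbout (κ : Encoder 𝒳 𝒯 M k d) (f : (Fin M → 𝒯) → β) : ℝ≥0∞ :=
  condMutualInfo (fun z : (𝒳 × (Fin M → 𝒯)) × Latent d => z.2) (fun z => f z.1.2)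
    (fun z => z.1.1) (jointLaw P κ)

/-- The law of `((h_k, X), f(S'))` where `S'` is a copy of `S` independent of `h_k` given `X`. -/
noncomputable def decoupledLaw (κ : Encoder 𝒳 𝒯 M k d) (f : (Fin M → 𝒯) → β) :
    Measure ((Latent d × 𝒳) × β) :=
  ((jointLaw P κ).map fun z => (z.2, z.1.1)) ⊗ₘ
    (condDistrib (fun y : 𝒳 × (Fin M → 𝒯) => f y.2) (fun y => y.1) P).prodMkLeft (Latent d)

instance (κ : Encoder 𝒳 𝒯 M k d) (f : (Fin M → 𝒯) → β) :
    IsFiniteMeasure (decoupledLaw P κ f) := by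
  unfold decoupledLaw; infer_instance

lemma measurable_lintegral_condDistrib_input (f : (Fin M → 𝒯) → β)
    {F : (Latent d × 𝒳) × β → ℝ≥0∞} (hF : Measurable F) :
    Measurable fun z : Latent d × 𝒳 =>
      ∫⁻ b, F (z, b) ∂(condDistrib (fun y : 𝒳 × (Fin M → 𝒯) => f y.2) (fun y => y.1) P z.2) :=
  Measurable.lintegral_kernel_prod_right' (κ := (condDistrib
    (fun y : 𝒳 × (Fin M → 𝒯) => f y.2) (fun y => y.1) P).prodMkLeft (Latent d)) (f := F) hF

lemma lintegral_decoupledLaw (κ : Encoder 𝒳 𝒯 M k d) {f : (Fin M → 𝒯) → β}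
    {F : (Latent d × 𝒳) × β → ℝ≥0∞} (hF : Measurable F) :
    ∫⁻ w, F w ∂(decoupledLaw P κ f) =
      ∫⁻ y, ∫⁻ h, ∫⁻ b, F ((h, y.1), b)
        ∂(condDistrib (fun y : 𝒳 × (Fin M → 𝒯) => f y.2) (fun y => y.1) P y.1)
        ∂(κ.kernel (y.1, past k y.2)) ∂P := by
  have h := measurable_lintegral_condDistrib_input P f hF
  rw [decoupledLaw, Measure.lintegral_compProd hF]
  simp only [Kernel.prodMkLeft_apply]
  rw [lintegral_map h (by fun_prop),
    lintegral_jointLaw P κ (F := fun z => ∫⁻ b, F ((z.2, z.1.1), b)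
      ∂(condDistrib (fun y : 𝒳 × (Fin M → 𝒯) => f y.2) (fun y => y.1) P z.1.1))
      (h.comp (by fun_prop : Measurable
        fun z : (𝒳 × (Fin M → 𝒯)) × Latent d => (z.2, z.1.1)))]

/-- The reference law can use the conditional law of `f(S)` under `P`, which does not involve the
encoder. Both laws are then affine in the encoder kernel, as time sharing requires. -/
lemma infoAbout_eq_klDiv (κ : Encoder 𝒳 𝒯 M k d) {f : (Fin M → 𝒯) → β} (hf : Measurable f) :
    infoAbout P κ f = klDiv (observationLaw P κ f) (decoupledLaw P κ f) := by
  rw [infoAbout, condMutualInfo_eq_klDiv (by fun_prop) (by fun_prop) (by fun_prop)]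
  congr 1
  refine Measure.compProd_congr ?_
  have h := condDistrib_jointLaw_ae_eq P κ hf
  have e : P.map (fun y => y.1) =
      ((jointLaw P κ).map fun z => (z.2, z.1.1)).map Prod.snd := by
    rw [Measure.map_map (by fun_prop) (by fun_prop), ← map_input_jointLaw P κ]
    rfl
  rw [e] at h
  filter_upwards [ae_of_ae_map (by fun_prop) h] with w hw
  exact hw

/-- **Data processing**: if the latent state depends on the chain through the input and `f(S)`
only, then it carries at most as much information about any `g(S)` as about `f(S)`. -/
lemma infoAbout_le_infoAbout (κ : Encoder 𝒳 𝒯 M k d) {f : (Fin M → 𝒯) → β} (hf : Measurable f)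
    {g : (Fin M → 𝒯) → γ} (hg : Measurable g) (K : Kernel (𝒳 × β) (Latent d)) [IsMarkovKernel K]
    (hK : ∀ y : 𝒳 × (Fin M → 𝒯), κ.kernel (y.1, past k y.2) = K (y.1, f y.2)) :
    infoAbout P κ g ≤ infoAbout P κ f := by
  set ηf := condDistrib (fun y : 𝒳 × (Fin M → 𝒯) => f y.2) (fun y => y.1) P with hηf
  set Q := condDistrib (fun y : 𝒳 × (Fin M → 𝒯) => g y.2) (fun y => (y.1, f y.2)) P with hQ
  -- The channel keeps `(h_k, X)` and draws `g(S)` from its law given `(X, f(S))`. It carries both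
  -- laws for `f` to those for `g`, and divergence decreases along a channel.
  set L : Kernel ((Latent d × 𝒳) × β) ((Latent d × 𝒳) × γ) :=
    Kernel.deterministic Prod.fst measurable_fst ×ₖ
      Q.comap (fun w => (w.1.2, w.2)) (by fun_prop) with hL
  have lintegral_L : ∀ {F : (Latent d × 𝒳) × γ → ℝ≥0∞}, Measurable F → ∀ w,
      ∫⁻ v, F v ∂(L w) = ∫⁻ c, F (w.1, c) ∂(Q (w.1.2, w.2)) := fun {F} hF w => by
    rw [hL, Kernel.prod_apply, Kernel.deterministic_apply, Kernel.comap_apply,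
      lintegral_prod _ hF.aemeasurable, lintegral_dirac' _ (by fun_prop)]
  have meas_Q : ∀ {F : (Latent d × 𝒳) × γ → ℝ≥0∞}, Measurable F →
      Measurable fun w : (Latent d × 𝒳) × β => ∫⁻ c, F (w.1, c) ∂(Q (w.1.2, w.2)) :=
    fun {F} hF => by
      simp_rw [← lintegral_L hF]
      exact hF.lintegral_kernel
  have hmarg : condDistrib (fun y : 𝒳 × (Fin M → 𝒯) => g y.2) (fun y => y.1) P
      =ᵐ[P.map fun y => y.1] (ηf ⊗ₖ Q).snd := by
    refine condDistrib_ae_eq_of_measure_eq_compProd _ (by fun_prop) ?_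
    refine Measure.ext_of_lintegral _ fun F hF => ?_
    have hF' : Measurable fun w : 𝒳 × β => ∫⁻ c, F (w.1, c) ∂(Q w) :=
      Measurable.lintegral_kernel_prod_right' (κ := Q) (f := fun v => F (v.1.1, v.2))
        (by fun_prop)
    rw [Measure.lintegral_compProd hF]
    calc ∫⁻ a, F a ∂(P.map fun y => (y.1, g y.2))
        = ∫⁻ v : (𝒳 × β) × γ, F (v.1.1, v.2) ∂(P.map fun y => ((y.1, f y.2), g y.2)) := by
          rw [lintegral_map hF (by fun_prop), lintegral_map (by fun_prop) (by fun_prop)]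
      _ = ∫⁻ w, ∫⁻ c, F (w.1, c) ∂(Q w) ∂(P.map fun y => (y.1, f y.2)) := by
          rw [← compProd_map_condDistrib (by fun_prop), Measure.lintegral_compProd (by fun_prop)]
      _ = ∫⁻ x, ∫⁻ b, ∫⁻ c, F (x, c) ∂(Q (x, b)) ∂(ηf x) ∂(P.map fun y => y.1) := by
          rw [← compProd_map_condDistrib (X := fun y : 𝒳 × (Fin M → 𝒯) => y.1)
            (Y := fun y => f y.2) (by fun_prop), Measure.lintegral_compProd hF']
      _ = _ := by
          refine lintegral_congr fun x => ?_
          rw [Kernel.lintegral_snd _ _ (by fun_prop), Kernel.lintegral_compProd _ _ _ (by fun_prop)]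
  -- Given `(X, f(S))`, the state and `g(S)` are independent by `hK`, so they can be drawn in either
  -- order.
  have hobs : observationLaw P κ g = L ∘ₘ observationLaw P κ f := by
    refine Measure.ext_of_lintegral _ fun F hF => ?_
    rw [Measure.lintegral_bind L.aemeasurable hF.aemeasurable]
    simp_rw [lintegral_L hF]
    rw [lintegral_observationLaw P κ hg hF, lintegral_observationLaw P κ hf (meas_Q hF)]
    simp_rw [hK]
    have hm : Measurable fun v : (𝒳 × β) × γ => ∫⁻ h, F ((h, v.1.1), v.2) ∂(K v.1) :=
      Measurable.lintegral_kernel_prod_right' (κ := K.prodMkRight γ)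
        (f := fun v : ((𝒳 × β) × γ) × Latent d => F ((v.2, v.1.1.1), v.1.2)) (by fun_prop)
    have hm2 : Measurable fun w : 𝒳 × β => ∫⁻ h, ∫⁻ c, F ((h, w.1), c) ∂(Q w) ∂(K w) :=
      Measurable.lintegral_kernel_prod_right' (κ := K)
        (f := fun v : (𝒳 × β) × Latent d => ∫⁻ c, F ((v.2, v.1.1), c) ∂(Q v.1))
        ((meas_Q hF).comp (by fun_prop : Measurable
          fun v : (𝒳 × β) × Latent d => ((v.2, v.1.1), v.1.2)))
    calc ∫⁻ y : 𝒳 × (Fin M → 𝒯), ∫⁻ h, F ((h, y.1), g y.2) ∂(K (y.1, f y.2)) ∂P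
        = ∫⁻ v, ∫⁻ h, F ((h, v.1.1), v.2) ∂(K v.1) ∂(P.map fun y => ((y.1, f y.2), g y.2)) := by
          rw [lintegral_map hm (by fun_prop)]
      _ = ∫⁻ w, ∫⁻ c, ∫⁻ h, F ((h, w.1), c) ∂(K w) ∂(Q w) ∂(P.map fun y => (y.1, f y.2)) := by
          rw [← compProd_map_condDistrib (by fun_prop), Measure.lintegral_compProd hm]
      _ = ∫⁻ w, ∫⁻ h, ∫⁻ c, F ((h, w.1), c) ∂(Q w) ∂(K w) ∂(P.map fun y => (y.1, f y.2)) := by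
          refine lintegral_congr fun w => ?_
          exact lintegral_lintegral_swap (by fun_prop)
      _ = _ := by rw [lintegral_map hm2 (by fun_prop)]
  have hdec : decoupledLaw P κ g = L ∘ₘ decoupledLaw P κ f := by
    refine Measure.ext_of_lintegral _ fun F hF => ?_
    rw [Measure.lintegral_bind L.aemeasurable hF.aemeasurable]
    simp_rw [lintegral_L hF]
    rw [lintegral_decoupledLaw P κ hF, lintegral_decoupledLaw P κ (meas_Q hF)]
    refine lintegral_congr_ae ?_
    filter_upwards [ae_of_ae_map (by fun_prop) hmarg] with y hy
    refine lintegral_congr fun h => ?_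
    rw [hy, Kernel.lintegral_snd _ _ (by fun_prop), Kernel.lintegral_compProd _ _ _ (by fun_prop)]
  rw [infoAbout_eq_klDiv P κ hf, infoAbout_eq_klDiv P κ hg, hobs, hdec]
  exact klDiv_comp_right_le _ _ L

end StandardBorel

end Encoders

/-! ### Gibbs inequality for the loss and data processing for the suffix -/

section Encoders

variable {𝒳 𝒯 : Type*} [MeasurableSpace 𝒳] [MeasurableSpace 𝒯] {M k d : ℕ}
  [Countable 𝒯] [MeasurableSingletonClass 𝒯] [Nonempty 𝒯]
  (P : Measure (𝒳 × (Fin M → 𝒯))) [IsProbabilityMeasure P]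

section Countable

variable {β : Type*} [MeasurableSpace β] [Countable β] [MeasurableSingletonClass β] [Nonempty β]

omit [Countable 𝒯] [MeasurableSingletonClass 𝒯] [Nonempty 𝒯] in
lemma condEntropy_jointLaw (κ : Encoder 𝒳 𝒯 M k d) {f : (Fin M → 𝒯) → β} (hf : Measurable f) :
    condEntropy (fun z : (𝒳 × (Fin M → 𝒯)) × Latent d => f z.1.2) (fun z => z.1.1)
      (jointLaw P κ) = condEntropy (fun y => f y.2) (fun y => y.1) P := by
  rw [condEntropy, condEntropy, map_input_jointLaw]
  refine lintegral_congr_ae ?_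
  filter_upwards [condDistrib_jointLaw_ae_eq P κ hf] with x hx
  rw [hx]

omit [Countable 𝒯] [MeasurableSingletonClass 𝒯] [Nonempty 𝒯] in
lemma condEntropy_add_infoAbout (κ : Encoder 𝒳 𝒯 M k d) {f : (Fin M → 𝒯) → β}
    (hf : Measurable f) :
    condEntropy (fun z : (𝒳 × (Fin M → 𝒯)) × Latent d => f z.1.2) (fun z => (z.2, z.1.1))
      (jointLaw P κ) + infoAbout P κ f = condEntropy (fun y => f y.2) (fun y => y.1) P := by
  rw [← condEntropy_jointLaw P κ hf]
  exact condEntropy_add_condMutualInfo (by fun_prop) (by fun_prop) (by fun_prop)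

omit [Countable 𝒯] [MeasurableSingletonClass 𝒯] [Nonempty 𝒯] in
lemma infoAbout_le_condEntropy (κ : Encoder 𝒳 𝒯 M k d) {f : (Fin M → 𝒯) → β}
    (hf : Measurable f) :
    infoAbout P κ f ≤ condEntropy (fun y => f y.2) (fun y => y.1) P :=
  (condEntropy_add_infoAbout P κ hf).symm ▸ le_add_self

end Countable

lemma latentEntropy_add_infoFuture (κ : Encoder 𝒳 𝒯 M k d) :
    latentEntropy P κ + infoFuture P κ = futureEntropy P k :=
  condEntropy_add_infoAbout P κ (measurable_future k)

/-- The excess loss is an expected relative entropy; the Gibbs inequality and its equality case are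
both read off from it. -/
lemma loss_eq_latentEntropy_add (κ : Encoder 𝒳 𝒯 M k d) (q : Decoder 𝒳 𝒯 M k d) :
    loss P κ q = latentEntropy P κ + ∫⁻ y, discreteKL
      (condDistrib (fun z : (𝒳 × (Fin M → 𝒯)) × Latent d => future k z.1.2)
        (fun z => (z.2, z.1.1)) (jointLaw P κ) y) (q.kernel y)
      ∂((jointLaw P κ).map fun z => (z.2, z.1.1)) := by
  have := q.isMarkov
  have hf := measurable_future (𝒯 := 𝒯) (M := M) k
  exact (condEntropy_add_lintegral_discreteKL (by fun_prop) (by fun_prop) q.kernel).symm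

lemma latentEntropy_le_loss (κ : Encoder 𝒳 𝒯 M k d) (q : Decoder 𝒳 𝒯 M k d) :
    latentEntropy P κ ≤ loss P κ q :=
  (loss_eq_latentEntropy_add P κ q).symm ▸ le_self_add

lemma latentEntropy_le_futureEntropy (κ : Encoder 𝒳 𝒯 M k d) :
    latentEntropy P κ ≤ futureEntropy P k :=
  (latentEntropy_add_infoFuture P κ).symm ▸ le_self_add

lemma infoFuture_le_futureEntropy (κ : Encoder 𝒳 𝒯 M k d) :
    infoFuture P κ ≤ futureEntropy P k :=
  (latentEntropy_add_infoFuture P κ).symm ▸ le_add_self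

/-- Equality case of the Gibbs inequality for the Coconut loss. -/
lemma loss_eq_latentEntropy_iff (hP : futureEntropy P k ≠ ⊤) (κ : Encoder 𝒳 𝒯 M k d)
    (q : Decoder 𝒳 𝒯 M k d) : loss P κ q = latentEntropy P κ ↔ IsPosterior P κ q := by
  have := q.isMarkov
  have h1 : latentEntropy P κ ≠ ⊤ := ne_top_of_le_ne_top hP (latentEntropy_le_futureEntropy P κ)
  rw [loss_eq_latentEntropy_add]
  nth_rw 2 [← add_zero (latentEntropy P κ)]
  rw [ENNReal.add_right_inj h1, lintegral_eq_zero_iff (measurable_discreteKL _ _), IsPosterior]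
  refine eventually_congr (Eventually.of_forall fun y => ?_)
  rw [Pi.zero_apply, discreteKL_eq_zero_iff, eq_comm]

/-- The suffix depends on the latent state through the prefix and the input only. -/
lemma infoFuture_le_infoPast (κ : Encoder 𝒳 𝒯 M k d) : infoFuture P κ ≤ infoPast P κ := by
  have := κ.isMarkov
  exact infoAbout_le_infoAbout P κ (measurable_past k) (measurable_future k) κ.kernel fun _ => rfl

/-- The encoder that ignores its input. -/
noncomputable def constEncoder (𝒳 𝒯 : Type*) [MeasurableSpace 𝒳] [MeasurableSpace 𝒯]
    (M k d : ℕ) : Encoder 𝒳 𝒯 M k d where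
  kernel := Kernel.const _ (Measure.dirac 0)
  isMarkov := inferInstance

/-- The state is generated from a constant function of the chain, so data processing bounds the
information by the entropy of a constant. -/
lemma infoPast_constEncoder : infoPast P (constEncoder 𝒳 𝒯 M k d) = 0 := by
  refine le_antisymm ?_ zero_le
  calc infoPast P (constEncoder 𝒳 𝒯 M k d)
      ≤ infoAbout P (constEncoder 𝒳 𝒯 M k d) (fun _ => ()) :=
        infoAbout_le_infoAbout P _ measurable_const (measurable_past k)
          (Kernel.const _ (Measure.dirac 0)) fun _ => rfl
    _ ≤ condEntropy (fun _ => ()) (fun y => y.1) P :=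
        infoAbout_le_condEntropy P _ measurable_const
    _ = 0 := by
        have h : ∀ μ : Measure Unit, [IsProbabilityMeasure μ] → ∀ a, μ.real {a} = 1 :=
          fun μ _ a => by
            rw [(Set.eq_univ_of_forall fun _ => rfl : ({a} : Set Unit) = Set.univ)]
            simp
        simp [condEntropy, h]

end Encoders

/-- The flag of a mixed encoder puts its two components on complementary sets, so the partition
formula leaves no cross term. -/
lemma klDiv_add_of_disjoint {α : Type*} [MeasurableSpace α] {μ₁ ν₁ μ₀ ν₀ : Measure α}
    [IsFiniteMeasure μ₁] [IsFiniteMeasure ν₁] [IsFiniteMeasure μ₀] [IsFiniteMeasure ν₀]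
    {s : Set α} (hs : MeasurableSet s) (hμ₁ : μ₁ sᶜ = 0) (hν₁ : ν₁ sᶜ = 0) (hμ₀ : μ₀ s = 0)
    (hν₀ : ν₀ s = 0) : klDiv (μ₁ + μ₀) (ν₁ + ν₀) = klDiv μ₁ ν₁ + klDiv μ₀ ν₀ := by
  rw [klDiv_eq_klDiv_restrict_add _ _ hs]
  have e₁ : ∀ {m : Measure α}, m sᶜ = 0 → m.restrict s = m ∧ m.restrict sᶜ = 0 := fun h =>
    ⟨Measure.restrict_eq_self_of_ae_mem h, Measure.restrict_eq_zero.2 h⟩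
  have e₀ : ∀ {m : Measure α}, m s = 0 → m.restrict sᶜ = m ∧ m.restrict s = 0 := fun h =>
    ⟨Measure.restrict_eq_self_of_ae_mem (compl_mem_ae_iff.2 h), Measure.restrict_eq_zero.2 h⟩
  simp [Measure.restrict_add, e₁ hμ₁, e₁ hν₁, e₀ hμ₀, e₀ hν₀]

/-! ### Flagged latent states -/

section Mixing

variable {𝒳 𝒯 : Type*} [MeasurableSpace 𝒳] [MeasurableSpace 𝒯] {M k d : ℕ}
  (P : Measure (𝒳 × (Fin M → 𝒯))) [IsProbabilityMeasure P]
  {β : Type*} [MeasurableSpace β] [StandardBorelSpace β] [Nonempty β]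

/-- For `d = 0` the latent space is a point and has no room for a flag, but there is only one
encoder, so nothing needs mixing or truncating. -/
lemma encoder_zero_eq (κ κ' : Encoder 𝒳 𝒯 M k 0) : κ = κ' := by
  obtain ⟨K, hK⟩ := κ
  obtain ⟨K', hK'⟩ := κ'
  congr 1
  ext z s hs
  rcases s.eq_empty_or_nonempty with h | h
  · simp [h]
  · simp [h.eq_univ]

/-- Both spaces are uncountable and standard Borel, hence Borel isomorphic; only the measurable
structure of the latent space matters. -/
lemma exists_flag_equiv (hd : d ≠ 0) : Nonempty (Bool × Latent d ≃ᵐ Latent d) := by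
  have : NeZero d := ⟨hd⟩
  have h : ¬ Countable (Latent d) := fun _ =>
    not_countable (α := ℝ) (Function.Injective.countable
      (f := fun x : ℝ => (EuclideanSpace.single 0 x : Latent d)) fun x y hxy => by
        simpa using congrArg (fun v : Latent d => v 0) hxy)
  have h' : ¬ Countable (Bool × Latent d) := fun _ =>
    h (Function.Injective.countable (f := fun v : Latent d => (true, v)) (Prod.mk_right_injective _))
  exact ⟨PolishSpace.measurableEquivOfNotCountable h' h⟩

/-- Time sharing: with probability `w` use `κ₁` and flag `true`, otherwise use `κ₀` and flag
`false`. -/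
noncomputable def mixEncoder (E : Bool × Latent d ≃ᵐ Latent d) {w : ℝ≥0} (hw : w ≤ 1)
    (κ₁ κ₀ : Encoder 𝒳 𝒯 M k d) : Encoder 𝒳 𝒯 M k d where
  kernel :=
    { toFun := fun z => w • (κ₁.kernel z).map (fun h => E (true, h)) +
        (1 - w) • (κ₀.kernel z).map (fun h => E (false, h))
      measurable' := by
        refine Measure.measurable_of_measurable_coe _ fun s hs => ?_
        have h1 : Measurable fun h : Latent d => E (true, h) := by fun_prop
        have h0 : Measurable fun h : Latent d => E (false, h) := by fun_prop
        simp only [Measure.add_apply, Measure.smul_apply, Measure.map_apply h1 hs,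
          Measure.map_apply h0 hs]
        exact ((κ₁.kernel.measurable_coe (h1 hs)).const_smul w).add
          ((κ₀.kernel.measurable_coe (h0 hs)).const_smul (1 - w)) }
  isMarkov := ⟨fun z => ⟨by
    have := κ₁.isMarkov
    have := κ₀.isMarkov
    have h1 : Measurable fun h : Latent d => E (true, h) := by fun_prop
    have h0 : Measurable fun h : Latent d => E (false, h) := by fun_prop
    change (w • (κ₁.kernel z).map (fun h => E (true, h)) +
      (1 - w) • (κ₀.kernel z).map (fun h => E (false, h))) Set.univ = 1
    simp only [Measure.add_apply, Measure.smul_apply, Measure.map_apply h1 .univ,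
      Measure.map_apply h0 .univ, Set.preimage_univ, measure_univ]
    rw [← ENNReal.coe_one, ENNReal.smul_def, ENNReal.smul_def]
    simp only [smul_eq_mul]
    norm_cast
    simp [hw]⟩⟩

lemma lintegral_mixEncoder (E : Bool × Latent d ≃ᵐ Latent d) {w : ℝ≥0} (hw : w ≤ 1)
    (κ₁ κ₀ : Encoder 𝒳 𝒯 M k d) (z : 𝒳 × Past 𝒯 M k) {F : Latent d → ℝ≥0∞}
    (hF : Measurable F) :
    ∫⁻ h, F h ∂((mixEncoder E hw κ₁ κ₀).kernel z) =
      w * ∫⁻ h, F (E (true, h)) ∂(κ₁.kernel z) +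
        (1 - w : ℝ≥0) * ∫⁻ h, F (E (false, h)) ∂(κ₀.kernel z) := by
  change ∫⁻ h, F h ∂(w • (κ₁.kernel z).map (fun h => E (true, h)) +
      (1 - w) • (κ₀.kernel z).map (fun h => E (false, h))) = _
  rw [lintegral_add_measure, lintegral_smul_measure, lintegral_smul_measure,
    lintegral_map hF (by fun_prop), lintegral_map hF (by fun_prop)]
  rfl

lemma lintegral_jointLaw_mixEncoder (E : Bool × Latent d ≃ᵐ Latent d) {w : ℝ≥0} (hw : w ≤ 1)
    (κ₁ κ₀ : Encoder 𝒳 𝒯 M k d) {G : (𝒳 × (Fin M → 𝒯)) × Latent d → ℝ≥0∞} (hG : Measurable G) :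
    ∫⁻ z, G z ∂(jointLaw P (mixEncoder E hw κ₁ κ₀)) =
      w * ∫⁻ z, G (z.1, E (true, z.2)) ∂(jointLaw P κ₁) +
        (1 - w : ℝ≥0) * ∫⁻ z, G (z.1, E (false, z.2)) ∂(jointLaw P κ₀) := by
  have h : ∀ (κ : Encoder 𝒳 𝒯 M k d) (i : Bool), Measurable fun y : 𝒳 × (Fin M → 𝒯) =>
      ∫⁻ h, G (y, E (i, h)) ∂(κ.kernel (y.1, past k y.2)) := fun κ i =>
    Measurable.lintegral_kernel_prod_right' (κ := κ.onChain) (f := fun z => G (z.1, E (i, z.2)))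
      (by fun_prop)
  rw [lintegral_jointLaw P _ hG, lintegral_jointLaw P _ (by fun_prop),
    lintegral_jointLaw P _ (by fun_prop), ← lintegral_const_mul _ (h _ _),
    ← lintegral_const_mul _ (h _ _), ← lintegral_add_left ((h _ _).const_mul _)]
  exact lintegral_congr fun y => lintegral_mixEncoder E hw κ₁ κ₀ _ (by fun_prop)

/-- Equality holds, not mere convexity, because the flag can be read from the state. Both laws are
weighted sums of pieces with distinct flags; divergence is additive over such pieces, homogeneous
under common scaling, and unchanged by the injective tagging `g i`. -/
lemma infoAbout_mixEncoder (E : Bool × Latent d ≃ᵐ Latent d) {w : ℝ≥0} (hw : w ≤ 1)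
    (κ₁ κ₀ : Encoder 𝒳 𝒯 M k d) {f : (Fin M → 𝒯) → β} (hf : Measurable f) :
    infoAbout P (mixEncoder E hw κ₁ κ₀) f =
      w * infoAbout P κ₁ f + (1 - w : ℝ≥0) * infoAbout P κ₀ f := by
  let g : Bool → (Latent d × 𝒳) × β → (Latent d × 𝒳) × β := fun i v => ((E (i, v.1.1), v.1.2), v.2)
  have hg : ∀ i, Measurable (g i) := fun i => by fun_prop
  let r : (Latent d × 𝒳) × β → (Latent d × 𝒳) × β := fun v => (((E.symm v.1.1).2, v.1.2), v.2)
  have hr : Measurable r := by fun_prop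
  have hrg : ∀ i, Function.LeftInverse r (g i) := fun i v => by simp [r, g]
  have hobs : observationLaw P (mixEncoder E hw κ₁ κ₀) f =
      w • (observationLaw P κ₁ f).map (g true) +
        (1 - w) • (observationLaw P κ₀ f).map (g false) := by
    refine Measure.ext_of_lintegral _ fun F hF => ?_
    have hFg : ∀ i, Measurable fun v => F (g i v) := fun i => hF.comp (hg i)
    rw [lintegral_add_measure, lintegral_smul_measure, lintegral_smul_measure,
      lintegral_map hF (hg _), lintegral_map hF (hg _)]
    simp only [observationLaw]
    rw [lintegral_map hF (by fun_prop), lintegral_map (hFg _) (by fun_prop),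
      lintegral_map (hFg _) (by fun_prop)]
    exact lintegral_jointLaw_mixEncoder P E hw κ₁ κ₀ (G := fun z => F ((z.2, z.1.1), f z.1.2))
      (by fun_prop)
  have hdec : decoupledLaw P (mixEncoder E hw κ₁ κ₀) f =
      w • (decoupledLaw P κ₁ f).map (g true) +
        (1 - w) • (decoupledLaw P κ₀ f).map (g false) := by
    refine Measure.ext_of_lintegral _ fun F hF => ?_
    have hFg : ∀ i, Measurable fun v => F (g i v) := fun i => hF.comp (hg i)
    have hc : ∀ {F : (Latent d × 𝒳) × β → ℝ≥0∞}, Measurable F → ∀ κ : Encoder 𝒳 𝒯 M k d,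
        ∫⁻ v, F v ∂(decoupledLaw P κ f) = ∫⁻ z, ∫⁻ b, F ((z.2, z.1.1), b)
          ∂(condDistrib (fun y : 𝒳 × (Fin M → 𝒯) => f y.2) (fun y => y.1) P z.1.1)
          ∂(jointLaw P κ) := fun {F} hF κ => by
      rw [decoupledLaw, Measure.lintegral_compProd hF]
      exact lintegral_map (measurable_lintegral_condDistrib_input P f hF) (by fun_prop)
    rw [lintegral_add_measure, lintegral_smul_measure, lintegral_smul_measure,
      lintegral_map hF (hg _), lintegral_map hF (hg _), hc hF, hc (hFg _),
      hc (hFg _)]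
    exact lintegral_jointLaw_mixEncoder P E hw κ₁ κ₀
      ((measurable_lintegral_condDistrib_input P f hF).comp
        (by fun_prop : Measurable fun z : (𝒳 × (Fin M → 𝒯)) × Latent d => (z.2, z.1.1)))
  let s : Set ((Latent d × 𝒳) × β) := {v | (E.symm v.1.1).1 = true}
  have hs : MeasurableSet s :=
    (by fun_prop : Measurable fun v : (Latent d × 𝒳) × β => (E.symm v.1.1).1)
      (measurableSet_singleton true)
  have h1 : g true ⁻¹' sᶜ = ∅ := by ext v; simp [g, s]
  have h0 : g false ⁻¹' s = ∅ := by ext v; simp [g, s]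
  rw [infoAbout_eq_klDiv P _ hf, infoAbout_eq_klDiv P _ hf, infoAbout_eq_klDiv P _ hf, hobs, hdec,
    klDiv_add_of_disjoint hs, klDiv_smul_same, klDiv_smul_same,
    klDiv_map_of_leftInverse _ _ (hg _) hr (hrg _), klDiv_map_of_leftInverse _ _ (hg _) hr (hrg _)]
  all_goals simp [Measure.map_apply (hg _), hs, hs.compl, h1, h0]

end Mixing

/-! ### Approximation by encoders of finite capacity -/

section Truncation

variable {𝒳 𝒯 : Type*} [MeasurableSpace 𝒳] [MeasurableSpace 𝒯] {M k d : ℕ}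
  [MeasurableSingletonClass 𝒯]

open Classical in
/-- The encoder that follows `κ` on the prefixes in `A`, and outputs an uninformative flagged state
on the other prefixes. -/
noncomputable def truncEncoder (E : Bool × Latent d ≃ᵐ Latent d) (A : Finset (Past 𝒯 M k))
    (κ : Encoder 𝒳 𝒯 M k d) : Encoder 𝒳 𝒯 M k d where
  kernel := Kernel.piecewise (s := {z | z.2 ∈ A}) (measurable_snd A.measurableSet)
    (κ.kernel.map fun h => E (true, h)) (Kernel.const _ (Measure.dirac (E (false, 0))))
  isMarkov := by
    have := κ.isMarkov
    have := Kernel.IsMarkovKernel.map κ.kernel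
      (by fun_prop : Measurable fun h : Latent d => E (true, h))
    infer_instance

lemma truncEncoder_of_mem (E : Bool × Latent d ≃ᵐ Latent d) {A : Finset (Past 𝒯 M k)}
    (κ : Encoder 𝒳 𝒯 M k d) {z : 𝒳 × Past 𝒯 M k} (hz : z.2 ∈ A) :
    (truncEncoder E A κ).kernel z = (κ.kernel z).map fun h => E (true, h) := by
  simp only [truncEncoder, Kernel.piecewise_apply, Set.mem_ofPred_eq, hz, if_true]
  rw [Kernel.map_apply _ (by fun_prop)]

lemma truncEncoder_of_notMem (E : Bool × Latent d ≃ᵐ Latent d) {A : Finset (Past 𝒯 M k)}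
    (κ : Encoder 𝒳 𝒯 M k d) {z : 𝒳 × Past 𝒯 M k} (hz : z.2 ∉ A) :
    (truncEncoder E A κ).kernel z = Measure.dirac (E (false, 0)) := by
  simp only [truncEncoder, Kernel.piecewise_apply, Set.mem_ofPred_eq, hz, if_false]
  rw [Kernel.const_apply]

variable [Countable 𝒯] [Nonempty 𝒯] (P : Measure (𝒳 × (Fin M → 𝒯))) [IsProbabilityMeasure P]

-- The state depends on the chain only through `f`, which records the prefix if it lies in the
-- finite set `A` and `none` otherwise. Data processing bounds the information by the finite entropy
-- of `f`.
open Classical in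
lemma infoPast_truncEncoder_ne_top (E : Bool × Latent d ≃ᵐ Latent d) (A : Finset (Past 𝒯 M k))
    (κ : Encoder 𝒳 𝒯 M k d) : infoPast P (truncEncoder E A κ) ≠ ⊤ := by
  have := (truncEncoder E A κ).isMarkov
  let f : (Fin M → 𝒯) → Option A := fun s => if h : past k s ∈ A then some ⟨past k s, h⟩ else none
  let _ : MeasurableSpace (Option A) := ⊤
  have hf : Measurable f := Measurable.of_discrete
  -- A dummy value at `none`, where `K` takes its other branch.
  let p₀ : Past 𝒯 M k := Classical.arbitrary _
  let u : 𝒳 × Option A → 𝒳 × Past 𝒯 M k := fun v => (v.1, (v.2.map Subtype.val).getD p₀)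
  have hu : Measurable u := by
    refine measurable_fst.prodMk ?_
    exact (Measurable.of_discrete (f := fun o : Option A => (o.map Subtype.val).getD p₀)).comp
      measurable_snd
  let K : Kernel (𝒳 × Option A) (Latent d) :=
    Kernel.piecewise (s := {v | v.2 = none}) (measurable_snd (measurableSet_singleton none))
      (Kernel.const _ (Measure.dirac (E (false, 0)))) ((truncEncoder E A κ).kernel.comap u hu)
  have hKM : IsMarkovKernel K := by
    have := Kernel.IsMarkovKernel.comap (truncEncoder E A κ).kernel hu
    exact Kernel.IsMarkovKernel.piecewise
  refine ne_top_of_le_ne_top (condEntropy_ne_top_of_finite (fun y => f y.2) (fun y => y.1) P)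
    (le_trans ?_ (infoAbout_le_condEntropy P (truncEncoder E A κ) hf))
  refine infoAbout_le_infoAbout P _ hf (measurable_past k) K fun y => ?_
  by_cases hy : past k y.2 ∈ A
  · simp [K, Kernel.piecewise_apply, f, hy, u, Kernel.comap_apply]
  · simp [K, Kernel.piecewise_apply, f, hy, truncEncoder_of_notMem E κ (z := (y.1, past k y.2)) hy]

open Classical in
/-- Truncating an encoder costs at most the code length of the suffix on the truncated part. -/
lemma latentEntropy_truncEncoder_le (E : Bool × Latent d ≃ᵐ Latent d) (A : Finset (Past 𝒯 M k))
    (κ : Encoder 𝒳 𝒯 M k d) : latentEntropy P (truncEncoder E A κ) ≤ latentEntropy P κ +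
      ∫⁻ y in {y | past k y.2 ∉ A}, codeLength (condDistrib
        (fun y : 𝒳 × (Fin M → 𝒯) => future k y.2) (fun y => y.1) P y.1 {future k y.2}) ∂P := by
  have hfut := measurable_future (𝒯 := 𝒯) (M := M) k
  set η := condDistrib (fun y : 𝒳 × (Fin M → 𝒯) => future k y.2) (fun y => y.1) P with hη
  set π := condDistrib (fun z : (𝒳 × (Fin M → 𝒯)) × Latent d => future k z.1.2)
    (fun z => (z.2, z.1.1)) (jointLaw P κ) with hπ
  have hs : MeasurableSet {v : Latent d × 𝒳 | (E.symm v.1).1 = true} :=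
    (by fun_prop : Measurable fun v : Latent d × 𝒳 => (E.symm v.1).1) (measurableSet_singleton true)
  -- This decoder reads the flag: under `true` it uses the posterior of `κ`, under `false` the law
  -- of the suffix given `X` alone. By the Gibbs inequality its loss bounds the entropy.
  let q : Decoder 𝒳 𝒯 M k d :=
    { kernel := Kernel.piecewise hs (π.comap (fun v => ((E.symm v.1).2, v.2)) (by fun_prop))
        (η.prodMkLeft (Latent d))
      isMarkov := inferInstance }
  have hq : ∀ h x, q.kernel (E (true, h), x) = π (h, x) := fun h x => by
    simp [q, Kernel.piecewise_apply, Kernel.comap_apply]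
  have hq' : ∀ h x, q.kernel (E (false, h), x) = η x := fun h x => by
    simp [q, Kernel.piecewise_apply, Kernel.prodMkLeft_apply]
  have meas : ∀ ρ : Kernel (Latent d × 𝒳) (Future 𝒯 M k),
      Measurable fun z : (𝒳 × (Fin M → 𝒯)) × Latent d =>
        codeLength (ρ (z.2, z.1.1) {future k z.1.2}) := fun ρ => by
    have h1 : Measurable fun v : (Latent d × 𝒳) × Future 𝒯 M k => codeLength (ρ v.1 {v.2}) :=
      measurable_codeLength.comp (measurable_from_prod_countable_left fun b =>
        ρ.measurable_coe (measurableSet_singleton b))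
    exact h1.comp (by fun_prop : Measurable
      fun z : (𝒳 × (Fin M → 𝒯)) × Latent d => ((z.2, z.1.1), future k z.1.2))
  have hA : MeasurableSet {y : 𝒳 × (Fin M → 𝒯) | past k y.2 ∈ A} :=
    ((measurable_past k).comp measurable_snd) A.measurableSet
  have hH : latentEntropy P κ = ∫⁻ y, ∫⁻ h, codeLength (π (h, y.1) {future k y.2})
      ∂(κ.kernel (y.1, past k y.2)) ∂P := by
    rw [latentEntropy, condEntropy_eq_lintegral_codeLength (by fun_prop) (by fun_prop),
      lintegral_jointLaw P κ (meas π)]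
  refine (latentEntropy_le_loss P _ q).trans ?_
  clear_value q
  have hl : loss P (truncEncoder E A κ) q = ∫⁻ y, ∫⁻ h, codeLength (q.kernel (h, y.1)
      {future k y.2}) ∂((truncEncoder E A κ).kernel (y.1, past k y.2)) ∂P :=
    lintegral_jointLaw P _ (meas q.kernel)
  rw [hl, hH, ← lintegral_add_compl _ hA]
  refine add_le_add (le_trans (le_of_eq ?_)
    (setLIntegral_le_lintegral {y : 𝒳 × (Fin M → 𝒯) | past k y.2 ∈ A} _)) (le_of_eq ?_)
  · refine setLIntegral_congr_fun hA fun y hy => ?_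
    have hm : Measurable fun h => codeLength (q.kernel (h, y.1) {future k y.2}) :=
      (meas q.kernel).comp (measurable_prodMk_left (x := y))
    beta_reduce
    rw [truncEncoder_of_mem E κ (z := (y.1, past k y.2)) hy, lintegral_map hm (by fun_prop)]
    exact lintegral_congr fun h => by rw [hq]
  · refine setLIntegral_congr_fun hA.compl fun y hy => ?_
    have hm : Measurable fun h => codeLength (q.kernel (h, y.1) {future k y.2}) :=
      (meas q.kernel).comp (measurable_prodMk_left (x := y))
    beta_reduce
    rw [truncEncoder_of_notMem E κ (z := (y.1, past k y.2)) hy, lintegral_dirac' _ hm, hq']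

/-- Encoders of finite capacity approximate the performance of every encoder. -/
lemma exists_infoPast_ne_top (hP : futureEntropy P k ≠ ⊤) (κ : Encoder 𝒳 𝒯 M k d) {ε : ℝ≥0∞}
    (hε : 0 < ε) : ∃ κ' : Encoder 𝒳 𝒯 M k d, infoPast P κ' ≠ ⊤ ∧
      latentEntropy P κ' ≤ latentEntropy P κ + ε := by
  by_cases hd : d = 0
  · subst hd
    refine ⟨κ, ?_, le_self_add⟩
    rw [encoder_zero_eq κ (constEncoder 𝒳 𝒯 M k 0), infoPast_constEncoder]
    exact ENNReal.zero_ne_top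
  obtain ⟨E⟩ := exists_flag_equiv hd
  have hfut := measurable_future (𝒯 := 𝒯) (M := M) k
  have hpast := measurable_past (𝒯 := 𝒯) (M := M) k
  set G : 𝒳 × (Fin M → 𝒯) → ℝ≥0∞ := fun y => codeLength (condDistrib
    (fun y : 𝒳 × (Fin M → 𝒯) => future k y.2) (fun y => y.1) P y.1 {future k y.2}) with hG
  have hmeas : ∀ p : Past 𝒯 M k, MeasurableSet {y : 𝒳 × (Fin M → 𝒯) | past k y.2 = p} := fun p =>
    (hpast.comp measurable_snd) (measurableSet_singleton p)
  -- Summed over all prefixes, the code length is `H(S_+ | X) < ∞`, so its tail outside some finite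
  -- set `A` is below `ε`.
  have htot : ∑' p : Past 𝒯 M k, ∫⁻ y in {y | past k y.2 = p}, G y ∂P ≠ ⊤ := by
    rw [← lintegral_iUnion hmeas]
    · refine ne_top_of_le_ne_top hP ((setLIntegral_le_lintegral _ _).trans (le_of_eq ?_))
      exact (condEntropy_eq_lintegral_codeLength (by fun_prop) (by fun_prop)).symm
    · intro p p' hpp
      exact Set.disjoint_left.2 fun y hy hy' => hpp (hy.symm.trans hy')
  obtain ⟨A, hA⟩ := ((ENNReal.tendsto_tsum_compl_atTop_zero htot).eventually_lt_const hε).exists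
  refine ⟨truncEncoder E A κ, infoPast_truncEncoder_ne_top P E A κ,
    (latentEntropy_truncEncoder_le P E A κ).trans (add_le_add_right (le_trans ?_ hA.le) _)⟩
  have hU : {y : 𝒳 × (Fin M → 𝒯) | past k y.2 ∉ A} =
      ⋃ p : {p : Past 𝒯 M k // p ∉ A}, {y | past k y.2 = p} := by
    ext y; simp
  rw [hU]
  exact lintegral_iUnion_le _ _

end Truncation

/-! ### Supergradients of concave functions on the half-line -/

section Concave

variable {F : ℝ → ℝ} {R L l : ℝ}

/-- Secant slopes of a concave function decrease: those to the left of `R` are at least their limit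
`L`, and those to the right are at most every left slope, hence at most `L`. -/
lemma supergradient_of_hasDerivWithinAt_Iio (hF : ConcaveOn ℝ (Set.Ici 0) F) (hR : 0 < R)
    (hL : HasDerivWithinAt F L (Set.Iio R) R) : ∀ r, 0 ≤ r → F r ≤ F R + L * (r - R) := by
  intro r hr
  rcases lt_trichotomy r R with h | h | h
  · have h1 := hF.le_slope_of_hasDerivWithinAt_Iio (x := r) (y := R) hr hR.le h hL
    rw [slope_def_field, le_div_iff₀ (by linarith)] at h1
    linarith
  · simp [h]
  · have h1 : slope F R r ≤ L := by
      refine ge_of_tendsto ((hasDerivWithinAt_iff_tendsto_slope' Set.self_notMem_Iio).1 hL) ?_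
      filter_upwards [Ioo_mem_nhdsLT hR] with t ht
      have h2 := hF.slope_anti_adjacent (x := t) (y := R) (z := r) ht.1.le hr ht.2 h
      rw [slope_comm F R t, slope_def_field, slope_def_field]
      exact h2
    rw [slope_def_field, div_le_iff₀ (by linarith)] at h1
    linarith

/-- A supergradient lies below every left secant slope. For concave `F` the left derivative is
therefore the largest supergradient. -/
lemma le_of_supergradient_of_hasDerivWithinAt_Iio (hR : 0 < R)
    (hL : HasDerivWithinAt F L (Set.Iio R) R) (hl : ∀ r, 0 ≤ r → F r ≤ F R + l * (r - R)) :
    l ≤ L := by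
  refine ge_of_tendsto ((hasDerivWithinAt_iff_tendsto_slope' Set.self_notMem_Iio).1 hL) ?_
  filter_upwards [Ioo_mem_nhdsLT hR] with t ht
  rw [slope_comm, slope_def_field, le_div_iff₀ (by linarith [ht.2])]
  linarith [hl t ht.1.le]

/-- Positivity of `R` puts it in the interior; at the endpoint `0` the slope of a concave function
may be infinite. -/
lemma exists_supergradient (hF : ConcaveOn ℝ (Set.Ici 0) F) (hR : 0 < R) :
    ∃ l, ∀ r, 0 ≤ r → F r ≤ F R + l * (r - R) := by
  have h := hF.neg.hasDerivWithinAt_leftDeriv_of_mem_interior (x := R) (by simpa using hR)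
  have h' := h.neg
  rw [neg_neg] at h'
  exact ⟨_, supergradient_of_hasDerivWithinAt_Iio hF hR h'⟩

/-- A supergradient `l` makes `R` an interior maximum of `F r - l * (r - R)`, so the derivative
vanishes there. -/
lemma supergradient_iff_of_hasDerivAt (hF : ConcaveOn ℝ (Set.Ici 0) F) (hR : 0 < R)
    (hL : HasDerivAt F L R) : (∀ r, 0 ≤ r → F r ≤ F R + l * (r - R)) ↔ L = l := by
  refine ⟨fun h => ?_, fun h => h ▸ supergradient_of_hasDerivWithinAt_Iio hF hR hL.hasDerivWithinAt⟩
  have h1 : HasDerivAt (fun r => F r - l * (r - R)) (L - l * 1) R :=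
    hL.sub (((hasDerivAt_id R).sub_const R).const_mul l)
  have h2 : IsLocalMax (fun r => F r - l * (r - R)) R := by
    filter_upwards [Ioi_mem_nhds hR] with r hr
    have := h r (le_of_lt hr)
    simp only [sub_self, mul_zero, sub_zero]
    linarith
  have := h2.hasDerivAt_eq_zero h1
  linarith

end Concave

/-! ### The efficiency frontier and the dual problem -/

section Duality

variable {𝒳 𝒯 : Type*} [MeasurableSpace 𝒳] [MeasurableSpace 𝒯] {M k d : ℕ}
  [Countable 𝒯] [MeasurableSingletonClass 𝒯] [Nonempty 𝒯]
  (P : Measure (𝒳 × (Fin M → 𝒯))) [IsProbabilityMeasure P]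

/-- Time sharing averages the information about the prefix and about the suffix. -/
lemma exists_mix (κ₁ κ₀ : Encoder 𝒳 𝒯 M k d) {w : ℝ≥0} (hw : w ≤ 1) :
    ∃ κ : Encoder 𝒳 𝒯 M k d,
      infoPast P κ = w * infoPast P κ₁ + (1 - w : ℝ≥0) * infoPast P κ₀ ∧
      infoFuture P κ = w * infoFuture P κ₁ + (1 - w : ℝ≥0) * infoFuture P κ₀ := by
  by_cases hd : d = 0
  · subst hd
    have h : ∀ x : ℝ≥0∞, x = w * x + (1 - w : ℝ≥0) * x := fun x => by
      rw [← add_mul, ← ENNReal.coe_add, add_tsub_cancel_of_le hw, ENNReal.coe_one, one_mul]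
    refine ⟨κ₁, ?_, ?_⟩ <;> rw [encoder_zero_eq κ₀ κ₁] <;> exact h _
  · obtain ⟨E⟩ := exists_flag_equiv hd
    exact ⟨mixEncoder E hw κ₁ κ₀, infoAbout_mixEncoder P E hw κ₁ κ₀ (measurable_past k),
      infoAbout_mixEncoder P E hw κ₁ κ₀ (measurable_future k)⟩

variable {P}
variable (hP : futureEntropy P k ≠ ⊤)
include hP

lemma infoFuture_ne_top (κ : Encoder 𝒳 𝒯 M k d) : infoFuture P κ ≠ ⊤ :=
  ne_top_of_le_ne_top hP (infoFuture_le_futureEntropy P κ)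

lemma latentEntropy_ne_top (κ : Encoder 𝒳 𝒯 M k d) : latentEntropy P κ ≠ ⊤ :=
  ne_top_of_le_ne_top hP (latentEntropy_le_futureEntropy P κ)

lemma latentEntropy_toReal (κ : Encoder 𝒳 𝒯 M k d) :
    (latentEntropy P κ).toReal = (futureEntropy P k).toReal - (infoFuture P κ).toReal := by
  rw [← latentEntropy_add_infoFuture P κ,
    ENNReal.toReal_add (latentEntropy_ne_top hP κ) (infoFuture_ne_top hP κ)]
  ring

lemma coe_latentEntropy (κ : Encoder 𝒳 𝒯 M k d) : (latentEntropy P κ : EReal) =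
    (((futureEntropy P k).toReal - (infoFuture P κ).toReal : ℝ) : EReal) := by
  rw [← latentEntropy_toReal hP, EReal.coe_ennreal_toReal (latentEntropy_ne_top hP κ)]

lemma iSup_infoFuture_ne_top (r : ℝ≥0∞) :
    (⨆ κ : Encoder 𝒳 𝒯 M k d, ⨆ _ : infoPast P κ ≤ r, infoFuture P κ) ≠ ⊤ :=
  ne_top_of_le_ne_top hP (iSup₂_le fun κ _ => infoFuture_le_futureEntropy P κ)

lemma infoFuture_le_efficiencyFrontier {κ : Encoder 𝒳 𝒯 M k d} {r : ℝ}
    (h : infoPast P κ ≤ ENNReal.ofReal r) :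
    (infoFuture P κ).toReal ≤ efficiencyFrontier P k d r :=
  ENNReal.toReal_mono (iSup_infoFuture_ne_top hP _)
    (le_iSup₂ (f := fun (κ : Encoder 𝒳 𝒯 M k d) (_ : infoPast P κ ≤ ENNReal.ofReal r) =>
      infoFuture P κ) κ h)

/-- The supremum defining the frontier need not be attained, so later arguments use encoders within
`ε` of it. -/
lemma exists_lt_infoFuture (d : ℕ) (r : ℝ) {ε : ℝ} (hε : 0 < ε) : ∃ κ : Encoder 𝒳 𝒯 M k d,
    infoPast P κ ≤ ENNReal.ofReal r ∧ efficiencyFrontier P k d r - ε < (infoFuture P κ).toReal := by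
  by_contra! h
  set S := ⨆ κ : Encoder 𝒳 𝒯 M k d, ⨆ _ : infoPast P κ ≤ ENNReal.ofReal r, infoFuture P κ with hS
  have hF : efficiencyFrontier P k d r = S.toReal := rfl
  -- Feasibility of the constant encoder excludes a negative bound, which `ENNReal.ofReal` would
  -- truncate.
  have h0 : 0 ≤ efficiencyFrontier P k d r - ε :=
    ENNReal.toReal_nonneg.trans (h (constEncoder 𝒳 𝒯 M k d)
      ((infoPast_constEncoder P).trans_le zero_le))
  have h1 : S ≤ ENNReal.ofReal (efficiencyFrontier P k d r - ε) := iSup₂_le fun κ hκ => by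
    rw [← ENNReal.ofReal_toReal (infoFuture_ne_top hP κ)]
    exact ENNReal.ofReal_le_ofReal (h κ hκ)
  have h2 := ENNReal.toReal_mono ENNReal.ofReal_ne_top h1
  rw [ENNReal.toReal_ofReal h0, ← hF] at h2
  linarith

lemma efficiencyFrontier_mono : Monotone (efficiencyFrontier P k d) := fun r r' h => by
  refine le_of_forall_pos_le_add fun ε hε => ?_
  obtain ⟨κ, h1, h2⟩ := exists_lt_infoFuture hP d r hε
  have := infoFuture_le_efficiencyFrontier hP (h1.trans (ENNReal.ofReal_le_ofReal h))
  linarith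

/-- Data processing, `I_+ ≤ I_-`. It bounds the slope of the frontier at the origin by one, which
settles capacity zero. -/
lemma efficiencyFrontier_le_self {r : ℝ} (hr : 0 ≤ r) : efficiencyFrontier P k d r ≤ r := by
  refine le_of_forall_pos_le_add fun ε hε => ?_
  obtain ⟨κ, h1, h2⟩ := exists_lt_infoFuture hP d r hε
  have := ENNReal.toReal_mono ENNReal.ofReal_ne_top ((infoFuture_le_infoPast P κ).trans h1)
  rw [ENNReal.toReal_ofReal hr] at this
  linarith

/-- Time sharing between near-optimal encoders for `r₁` and `r₀`, with weights `a` and `b`. -/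
lemma concaveOn_efficiencyFrontier : ConcaveOn ℝ (Set.Ici 0) (efficiencyFrontier P k d) := by
  refine ⟨convex_Ici 0, fun r₁ hr₁ r₀ hr₀ a b ha hb hab => ?_⟩
  rw [Set.mem_Ici] at hr₁ hr₀
  simp only [smul_eq_mul]
  refine le_of_forall_pos_le_add fun ε hε => ?_
  obtain ⟨κ₁, h1, h1'⟩ := exists_lt_infoFuture hP d r₁ hε
  obtain ⟨κ₀, h0, h0'⟩ := exists_lt_infoFuture hP d r₀ hε
  have hw : a.toNNReal ≤ 1 := by rw [Real.toNNReal_le_one]; linarith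
  have hb' : (1 - a.toNNReal : ℝ≥0) = b.toNNReal := by
    refine NNReal.eq ?_
    rw [NNReal.coe_sub hw, Real.coe_toNNReal _ ha, Real.coe_toNNReal _ hb, NNReal.coe_one]
    linarith
  obtain ⟨κ, hI, hJ⟩ := exists_mix P κ₁ κ₀ hw
  rw [hb'] at hI hJ
  have h2 : infoPast P κ ≤ ENNReal.ofReal (a * r₁ + b * r₀) := by
    rw [hI, ENNReal.ofReal_add (by positivity) (by positivity), ENNReal.ofReal_mul ha,
      ENNReal.ofReal_mul hb]
    exact add_le_add (mul_le_mul_right h1 _) (mul_le_mul_right h0 _)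
  have h3 := infoFuture_le_efficiencyFrontier hP h2
  rw [hJ, ENNReal.toReal_add (ENNReal.mul_ne_top ENNReal.coe_ne_top (infoFuture_ne_top hP _))
    (ENNReal.mul_ne_top ENNReal.coe_ne_top (infoFuture_ne_top hP _)), ENNReal.toReal_mul,
    ENNReal.toReal_mul, ENNReal.coe_toReal, ENNReal.coe_toReal, Real.coe_toNNReal _ ha,
    Real.coe_toNNReal _ hb] at h3
  have h4 := mul_le_mul_of_nonneg_left h1'.le ha
  have h5 := mul_le_mul_of_nonneg_left h0'.le hb
  have h6 : a * (efficiencyFrontier P k d r₁ - ε) + b * (efficiencyFrontier P k d r₀ - ε) =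
    a * efficiencyFrontier P k d r₁ + b * efficiencyFrontier P k d r₀ - ε := by
    linear_combination (-ε) * hab
  linarith

/-- The primal value is the entropy of the suffix lowered by the efficiency frontier. -/
lemma coe_primalValue (R : ℝ≥0) : (primalValue P k d R : EReal) =
    (((futureEntropy P k).toReal - efficiencyFrontier P k d R : ℝ) : EReal) := by
  have hle : primalValue P k d R ≤ futureEntropy P k :=
    (iInf₂_le (constEncoder 𝒳 𝒯 M k d) ((infoPast_constEncoder P).trans_le zero_le)).trans
      (latentEntropy_le_futureEntropy P _)
  have hne := ne_top_of_le_ne_top hP hle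
  rw [← EReal.coe_ennreal_toReal hne]
  congr 1
  refine le_antisymm (le_of_forall_pos_le_add fun ε hε => ?_) ?_
  · obtain ⟨κ, h1, h2⟩ := exists_lt_infoFuture hP d (R : ℝ) hε
    rw [ENNReal.ofReal_coe_nnreal] at h1
    have h3 := ENNReal.toReal_mono (latentEntropy_ne_top hP κ)
      (iInf₂_le (f := fun (κ : Encoder 𝒳 𝒯 M k d) (_ : infoPast P κ ≤ R) => latentEntropy P κ) κ h1)
    rw [latentEntropy_toReal hP] at h3
    change (primalValue P k d R).toReal ≤ _ at h3
    linarith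
  · rw [← ENNReal.ofReal_le_iff_le_toReal hne]
    refine le_iInf₂ fun κ hκ => ?_
    rw [← ENNReal.ofReal_toReal (latentEntropy_ne_top hP κ), latentEntropy_toReal hP]
    refine ENNReal.ofReal_le_ofReal (sub_le_sub_left ?_ _)
    exact infoFuture_le_efficiencyFrontier hP (by rwa [ENNReal.ofReal_coe_nnreal])

lemma lagrangian_eq_coe (R : ℝ≥0) (l : ℝ) {κ : Encoder 𝒳 𝒯 M k d} (hκ : infoPast P κ ≠ ⊤) :
    lagrangian P R l κ = (((futureEntropy P k).toReal - (infoFuture P κ).toReal +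
      l * ((infoPast P κ).toReal - R) : ℝ) : EReal) := by
  rw [lagrangian, coe_latentEntropy hP, ← EReal.coe_ennreal_toReal hκ]
  norm_cast

omit hP in
lemma lagrangian_eq_top (R : ℝ≥0) {l : ℝ} (hl : 0 < l) {κ : Encoder 𝒳 𝒯 M k d}
    (hκ : infoPast P κ = ⊤) : lagrangian P R l κ = ⊤ := by
  rw [lagrangian, hκ, EReal.coe_ennreal_top, EReal.top_sub_coe, EReal.coe_mul_top_of_pos hl,
    EReal.add_top_of_ne_bot (EReal.coe_ennreal_ne_bot _)]

omit hP in
-- As `0 * ⊤ = 0` in `EReal`, encoders of infinite capacity still compete at multiplier zero, unlike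
-- at positive multipliers.
lemma lagrangian_zero (R : ℝ≥0) (κ : Encoder 𝒳 𝒯 M k d) :
    lagrangian P R 0 κ = latentEntropy P κ := by
  simp [lagrangian]

/-- Weak duality. -/
lemma dualFunction_le_primalValue (R : ℝ≥0) {l : ℝ} (hl : 0 ≤ l) :
    dualFunction P k d R l ≤ primalValue P k d R := by
  rw [coe_primalValue hP, ← EReal.le_of_forall_lt_iff_le]
  intro z hz
  rw [EReal.coe_lt_coe_iff] at hz
  obtain ⟨κ, h1, h2⟩ := exists_lt_infoFuture hP d (R : ℝ) (sub_pos.2 hz)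
  have h3 : infoPast P κ ≠ ⊤ := ne_top_of_le_ne_top ENNReal.ofReal_ne_top h1
  refine (iInf_le _ κ).trans ?_
  rw [lagrangian_eq_coe hP R l h3, EReal.coe_le_coe_iff]
  have h4 : (infoPast P κ).toReal ≤ R := by
    have := ENNReal.toReal_mono ENNReal.ofReal_ne_top h1
    rwa [ENNReal.toReal_ofReal (NNReal.coe_nonneg R)] at this
  have h5 := mul_nonneg hl (sub_nonneg.2 h4)
  linarith

/-- A multiplier closes the duality gap iff it is a supergradient of the efficiency frontier. -/
lemma dualFunction_eq_primalValue_iff (R : ℝ≥0) {l : ℝ} (hl : 0 ≤ l) :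
    dualFunction P k d R l = primalValue P k d R ↔ ∀ r, 0 ≤ r →
      efficiencyFrontier P k d r ≤ efficiencyFrontier P k d R + l * (r - R) := by
  constructor
  · intro h r hr
    refine le_of_forall_pos_le_add fun ε hε => ?_
    obtain ⟨κ, h1, h2⟩ := exists_lt_infoFuture hP d r hε
    have h3 : infoPast P κ ≠ ⊤ := ne_top_of_le_ne_top ENNReal.ofReal_ne_top h1
    have h4 : dualFunction P k d R l ≤ lagrangian P R l κ := iInf_le _ κ
    rw [h, coe_primalValue hP, lagrangian_eq_coe hP R l h3, EReal.coe_le_coe_iff] at h4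
    have h5 : (infoPast P κ).toReal ≤ r := by
      have := ENNReal.toReal_mono ENNReal.ofReal_ne_top h1
      rwa [ENNReal.toReal_ofReal hr] at this
    have h6 := mul_le_mul_of_nonneg_left h5 hl
    linarith
  · intro h
    -- The supergradient inequality at `r = I_-(κ)`.
    have key : ∀ κ : Encoder 𝒳 𝒯 M k d, infoPast P κ ≠ ⊤ → (infoFuture P κ).toReal ≤
        efficiencyFrontier P k d R + l * ((infoPast P κ).toReal - R) := fun κ hκ =>
      (infoFuture_le_efficiencyFrontier hP (ENNReal.ofReal_toReal hκ).ge).trans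
        (h _ ENNReal.toReal_nonneg)
    refine le_antisymm (dualFunction_le_primalValue hP R hl) (le_iInf fun κ => ?_)
    rw [coe_primalValue hP]
    by_cases hκ : infoPast P κ = ⊤
    · rcases hl.eq_or_lt with h0 | h0
      -- At multiplier zero an encoder with `I_- = ∞` is replaced by one of finite capacity, at the
      -- price of `ε`.
      · rw [← h0, lagrangian_zero, coe_latentEntropy hP, EReal.coe_le_coe_iff]
        refine le_of_forall_pos_le_add fun ε hε => ?_
        obtain ⟨κ', h1, h2⟩ := exists_infoPast_ne_top P hP κ (ENNReal.ofReal_pos.2 hε)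
        have h3 := ENNReal.toReal_mono (by finiteness [latentEntropy_ne_top hP κ]) h2
        rw [ENNReal.toReal_add (latentEntropy_ne_top hP κ) ENNReal.ofReal_ne_top,
          ENNReal.toReal_ofReal hε.le, latentEntropy_toReal hP, latentEntropy_toReal hP] at h3
        have h4 := key κ' h1
        rw [← h0] at h4
        linarith
      · rw [lagrangian_eq_top R h0 hκ]
        exact le_top
    · rw [lagrangian_eq_coe hP R l hκ, EReal.coe_le_coe_iff]
      linarith [key κ hκ]

lemma isTradeoff_iff (R : ℝ≥0) (b : ℝ) : IsTradeoff P k d R b ↔ 0 < b ∧ ∀ r, 0 ≤ r →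
    efficiencyFrontier P k d r ≤ efficiencyFrontier P k d R + b⁻¹ * (r - R) :=
  and_congr_right fun hb => dualFunction_eq_primalValue_iff hP R (inv_nonneg.2 hb.le)

/-- Strong duality with dual attainment. -/
lemma exists_dualFunction_eq_primalValue (d : ℕ) (R : ℝ≥0) :
    ∃ l, 0 ≤ l ∧ dualFunction P k d R l = primalValue P k d R := by
  rcases eq_zero_or_pos R with h0 | h0
  -- At capacity zero the multiplier `1` works, by `F(r) ≤ r` and `F(0) ≥ 0`.
  · refine ⟨1, zero_le_one, (dualFunction_eq_primalValue_iff hP R zero_le_one).2 fun r hr => ?_⟩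
    have h1 : 0 ≤ efficiencyFrontier P k d R := ENNReal.toReal_nonneg
    have h2 := efficiencyFrontier_le_self (d := d) hP hr
    rw [h0] at h1 ⊢
    push_cast at h1 ⊢
    linarith
  · obtain ⟨l, hl⟩ := exists_supergradient (concaveOn_efficiencyFrontier (d := d) hP)
      (NNReal.coe_pos.2 h0)
    -- Monotonicity of the frontier, tested at `R + 1`, makes the supergradient nonnegative.
    have hl0 : 0 ≤ l := by
      have h1 := hl (R + 1) (by positivity)
      have h2 := efficiencyFrontier_mono (d := d) hP (by linarith : (R : ℝ) ≤ R + 1)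
      linarith
    exact ⟨l, hl0, (dualFunction_eq_primalValue_iff hP R hl0).2 hl⟩

end Duality

/-! ### The Lagrangian as a CIB objective, solutions, and trade-off parameters -/

lemma coe_mul_add_le_iff {l : ℝ} (hl : 0 < l) (c : ℝ) (x y : EReal) :
    (l : EReal) * x + c ≤ (l : EReal) * y + c ↔ x ≤ y := by
  have hl' : (0 : EReal) < l := by exact_mod_cast hl
  constructor
  · intro h
    have h1 := EReal.sub_le_sub h (le_refl (c : EReal))
    rw [EReal.add_sub_cancel_right, EReal.add_sub_cancel_right, mul_comm,
      ← EReal.le_div_iff_mul_le hl' (EReal.coe_ne_top l), ← EReal.mul_div,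
      EReal.mul_div_cancel (EReal.coe_ne_bot l) (EReal.coe_ne_top l) hl'.ne'] at h1
    exact h1
  · intro h
    gcongr

lemma iInf_coe_mul_add {ι : Type*} {l : ℝ} (hl : 0 < l) (c : ℝ) (x : ι → EReal) :
    ⨅ i, ((l : EReal) * x i + c) = (l : EReal) * (⨅ i, x i) + c := by
  have hl' : (0 : EReal) < l := by exact_mod_cast hl
  refine le_antisymm ?_ (le_iInf fun i => (coe_mul_add_le_iff hl c _ _).2 (iInf_le _ i))
  rw [← EReal.sub_le_iff_le_add (.inl (EReal.coe_ne_bot c)) (.inl (EReal.coe_ne_top c)),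
    ← EReal.div_le_iff_le_mul hl' (EReal.coe_ne_top l)]
  refine le_iInf fun i => ?_
  rw [EReal.div_le_iff_le_mul hl' (EReal.coe_ne_top l),
    EReal.sub_le_iff_le_add (.inl (EReal.coe_ne_bot c)) (.inl (EReal.coe_ne_top c))]
  exact iInf_le _ i

section Solutions

variable {𝒳 𝒯 : Type*} [MeasurableSpace 𝒳] [MeasurableSpace 𝒯] {M k d : ℕ}
  [Countable 𝒯] [MeasurableSingletonClass 𝒯] [Nonempty 𝒯]
  {P : Measure (𝒳 × (Fin M → 𝒯))} [IsProbabilityMeasure P]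

/-! ### Minimizers of the loss over a well-specified family -/

section Loss

variable {Θ : Type*} {enc : Θ → Encoder 𝒳 𝒯 M k d} {dec : Θ → Decoder 𝒳 𝒯 M k d} {R : ℝ≥0∞}

lemma iInf_loss_eq_primalValue (hP : futureEntropy P k ≠ ⊤) (h : WellSpecified P enc dec R) :
    ⨅ θ, ⨅ _ : infoPast P (enc θ) ≤ R, loss P (enc θ) (dec θ) = primalValue P k d R := by
  refine le_antisymm (le_iInf₂ fun κ hκ => ?_) (le_iInf₂ fun θ hθ => ?_)
  · obtain ⟨θ, rfl, hθ⟩ := h κ hκ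
    exact (iInf₂_le θ hκ).trans_eq ((loss_eq_latentEntropy_iff P hP _ _).2 hθ)
  · exact (iInf₂_le (enc θ) hθ).trans (latentEntropy_le_loss P _ _)

lemma isLossSolution_iff (hP : futureEntropy P k ≠ ⊤) (h : WellSpecified P enc dec R) (θ : Θ) :
    IsLossSolution P enc dec R θ ↔
      IsPrimalSolution P R (enc θ) ∧ IsPosterior P (enc θ) (dec θ) := by
  constructor
  · rintro ⟨h1, h2⟩
    -- Compare with the parameter realizing `κ` together with its posterior. Taking `κ = enc θ` then
    -- forces equality in the Gibbs inequality for `θ` itself.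
    have key : ∀ κ : Encoder 𝒳 𝒯 M k d, infoPast P κ ≤ R →
        loss P (enc θ) (dec θ) ≤ latentEntropy P κ := fun κ hκ => by
      obtain ⟨θ', rfl, hθ'⟩ := h κ hκ
      exact (h2 θ' hκ).trans_eq ((loss_eq_latentEntropy_iff P hP _ _).2 hθ')
    exact ⟨⟨h1, fun κ hκ => (latentEntropy_le_loss P _ _).trans (key κ hκ)⟩,
      (loss_eq_latentEntropy_iff P hP _ _).1 ((key _ h1).antisymm (latentEntropy_le_loss P _ _))⟩
  · rintro ⟨⟨h1, h2⟩, h3⟩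
    refine ⟨h1, fun θ' hθ' => ?_⟩
    rw [(loss_eq_latentEntropy_iff P hP _ _).2 h3]
    exact (h2 _ hθ').trans (latentEntropy_le_loss P _ _)

lemma isPrimalSolution_iff_exists_isLossSolution (hP : futureEntropy P k ≠ ⊤)
    (h : WellSpecified P enc dec R) (κ : Encoder 𝒳 𝒯 M k d) :
    IsPrimalSolution P R κ ↔ ∃ θ, enc θ = κ ∧ IsLossSolution P enc dec R θ := by
  constructor
  · intro hκ
    obtain ⟨θ, rfl, hθ⟩ := h κ hκ.1
    exact ⟨θ, rfl, (isLossSolution_iff hP h θ).2 ⟨hκ, hθ⟩⟩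
  · rintro ⟨θ, rfl, hθ⟩
    exact ((isLossSolution_iff hP h θ).1 hθ).1

end Loss

variable (hP : futureEntropy P k ≠ ⊤)
include hP

lemma cibObjective_eq_coe (b : ℝ) {κ : Encoder 𝒳 𝒯 M k d} (hκ : infoPast P κ ≠ ⊤) :
    cibObjective P b κ = (((infoPast P κ).toReal - b * (infoFuture P κ).toReal : ℝ) : EReal) := by
  rw [cibObjective, ← EReal.coe_ennreal_toReal hκ,
    ← EReal.coe_ennreal_toReal (infoFuture_ne_top hP κ)]
  norm_cast

lemma cibObjective_eq_top (b : ℝ) {κ : Encoder 𝒳 𝒯 M k d} (hκ : infoPast P κ = ⊤) :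
    cibObjective P b κ = ⊤ := by
  rw [cibObjective, hκ, ← EReal.coe_ennreal_toReal (infoFuture_ne_top hP κ), ← EReal.coe_mul,
    EReal.coe_ennreal_top, EReal.top_sub_coe]

/-- Substitute `H = H(S_+ | X) - I_+` and factor out `l`. If `I_-` is infinite, both sides are `⊤`
because `l > 0`. -/
lemma lagrangian_eq_cibObjective (R : ℝ≥0) {l : ℝ} (hl : 0 < l) (κ : Encoder 𝒳 𝒯 M k d) :
    lagrangian P R l κ = (l : EReal) * cibObjective P l⁻¹ κ +
      (((futureEntropy P k).toReal - l * R : ℝ) : EReal) := by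
  by_cases hκ : infoPast P κ = ⊤
  · rw [lagrangian_eq_top R hl hκ, cibObjective_eq_top hP _ hκ, EReal.coe_mul_top_of_pos hl,
      EReal.top_add_coe]
  · rw [lagrangian_eq_coe hP R l hκ, cibObjective_eq_coe hP _ hκ, ← EReal.coe_mul,
      ← EReal.coe_add]
    congr 1
    field_simp
    ring

lemma coe_futureEntropy_sub (c : ℝ) : (futureEntropy P k : EReal) - (c : EReal) =
    (((futureEntropy P k).toReal - c : ℝ) : EReal) := by
  rw [EReal.coe_sub, EReal.coe_ennreal_toReal hP]

lemma dualFunction_eq_iInf_cibObjective (d : ℕ) (R : ℝ≥0) {l : ℝ} (hl : 0 < l) :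
    dualFunction P k d R l = (l : EReal) * (⨅ κ : Encoder 𝒳 𝒯 M k d, cibObjective P l⁻¹ κ) +
      (((futureEntropy P k).toReal - l * R : ℝ) : EReal) := by
  rw [← iInf_coe_mul_add hl, dualFunction]
  exact iInf_congr fun κ => lagrangian_eq_cibObjective hP R hl κ

lemma forall_lagrangian_le_iff (R : ℝ≥0) {l : ℝ} (hl : 0 < l) (κ : Encoder 𝒳 𝒯 M k d) :
    (∀ κ' : Encoder 𝒳 𝒯 M k d, lagrangian P R l κ ≤ lagrangian P R l κ') ↔
      IsCIBSolution P l⁻¹ κ := by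
  refine forall_congr' fun κ' => ?_
  rw [lagrangian_eq_cibObjective hP R hl, lagrangian_eq_cibObjective hP R hl,
    coe_mul_add_le_iff hl]

/-- An attained multiplier `0` would give `v(R) = inf H`, contrary to `h`; so the multiplier is
positive and can be inverted. -/
lemma exists_isTradeoff_of_lt (R : ℝ≥0)
    (h : (⨅ κ : Encoder 𝒳 𝒯 M k d, latentEntropy P κ) < primalValue P k d R) :
    ∃ b, IsTradeoff P k d R b := by
  obtain ⟨l, hl, hl'⟩ := exists_dualFunction_eq_primalValue hP d R
  rcases hl.eq_or_lt with h0 | h0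
  · exfalso
    obtain ⟨κ, hκ⟩ := iInf_lt_iff.1 h
    refine absurd hl' (ne_of_lt ((iInf_le _ κ).trans_lt ?_))
    rw [← h0, lagrangian_zero]
    exact EReal.coe_ennreal_lt_coe_ennreal_iff.2 hκ
  · exact ⟨l⁻¹, inv_pos.2 h0, by rwa [inv_inv]⟩

lemma infoPast_ne_top_of_isCIBSolution {b : ℝ} {κ : Encoder 𝒳 𝒯 M k d}
    (h : IsCIBSolution P b κ) : infoPast P κ ≠ ⊤ := fun hκ => by
  have h0 : infoPast P (constEncoder 𝒳 𝒯 M k d) ≠ ⊤ := by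
    rw [infoPast_constEncoder]; exact ENNReal.zero_ne_top
  have h1 := h (constEncoder 𝒳 𝒯 M k d)
  rw [cibObjective_eq_top hP b hκ, cibObjective_eq_coe hP b h0, top_le_iff] at h1
  exact EReal.coe_ne_top _ h1

/-- Complementary slackness. With zero gap a primal solution minimizes the Lagrangian, and
positivity of `b⁻¹` forces it to exhaust the capacity. Conversely the Lagrangian equals the entropy
when `I_- = R`. -/
lemma isPrimalSolution_iff_of_isTradeoff {R : ℝ≥0} {b : ℝ} (hb : IsTradeoff P k d R b)
    (κ : Encoder 𝒳 𝒯 M k d) :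
    IsPrimalSolution P R κ ↔ IsCIBSolution P b κ ∧ infoPast P κ = R := by
  have hl : 0 < b⁻¹ := inv_pos.2 hb.1
  have h1 := forall_lagrangian_le_iff hP R hl κ
  rw [inv_inv] at h1
  rw [← h1]
  constructor
  · rintro ⟨hκ, hmin⟩
    have hne : infoPast P κ ≠ ⊤ := ne_top_of_le_ne_top ENNReal.coe_ne_top hκ
    have hr : (infoPast P κ).toReal ≤ R := ENNReal.toReal_mono ENNReal.coe_ne_top hκ
    have hv : primalValue P k d R = latentEntropy P κ :=
      le_antisymm (iInf₂_le κ hκ) (le_iInf₂ hmin)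
    have hle : ∀ κ' : Encoder 𝒳 𝒯 M k d, (latentEntropy P κ : EReal) ≤ lagrangian P R b⁻¹ κ' :=
      fun κ' => by rw [← hv, ← hb.2]; exact iInf_le _ κ'
    have h2 := hle κ
    rw [lagrangian_eq_coe hP _ _ hne, coe_latentEntropy hP, EReal.coe_le_coe_iff] at h2
    have h3 : 0 ≤ b⁻¹ * ((infoPast P κ).toReal - R) := by linarith
    have h4 : (infoPast P κ).toReal = R := by
      have := nonneg_of_mul_nonneg_right h3 hl
      linarith
    refine ⟨fun κ' => le_trans (le_of_eq ?_) (hle κ'), ?_⟩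
    · rw [lagrangian_eq_coe hP _ _ hne, coe_latentEntropy hP, h4, sub_self, mul_zero, add_zero]
    · rw [← ENNReal.toReal_eq_toReal_iff' hne ENNReal.coe_ne_top, h4]
      rfl
  · rintro ⟨hmin, hκ⟩
    have h2 : lagrangian P R b⁻¹ κ = latentEntropy P κ := by
      rw [lagrangian_eq_coe hP _ _ (hκ ▸ ENNReal.coe_ne_top), coe_latentEntropy hP, hκ]
      simp
    refine ⟨hκ.le, fun κ' hκ' => ?_⟩
    rw [← EReal.coe_ennreal_le_coe_ennreal_iff, ← h2]
    calc lagrangian P R b⁻¹ κ ≤ dualFunction P k d R b⁻¹ := le_iInf hmin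
      _ = primalValue P k d R := hb.2
      _ ≤ latentEntropy P κ' := EReal.coe_ennreal_le_coe_ennreal_iff.2 (iInf₂_le κ' hκ')

lemma exists_isTradeoff_of_isCIBSolution {b : ℝ} {κ : Encoder 𝒳 𝒯 M k d} (hb : 0 < b)
    (h : IsCIBSolution P b κ) :
    ∃ R : ℝ≥0, infoPast P κ = R ∧ IsPrimalSolution P R κ ∧ IsTradeoff P k d R b := by
  have hne := infoPast_ne_top_of_isCIBSolution hP h
  obtain ⟨R, hR⟩ : ∃ R : ℝ≥0, (R : ℝ≥0∞) = infoPast P κ := ⟨_, ENNReal.coe_toNNReal hne⟩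
  have hl : 0 < b⁻¹ := inv_pos.2 hb
  have h1 := (forall_lagrangian_le_iff hP R hl κ).2 (by rwa [inv_inv])
  have h2 : lagrangian P R b⁻¹ κ = latentEntropy P κ := by
    rw [lagrangian_eq_coe hP _ _ hne, coe_latentEntropy hP, ← hR]
    simp
  have ht : IsTradeoff P k d R b := by
    -- The gap closes by the circle `v(R) ≤ H(κ) = J(κ) ≤ g ≤ v(R)`.
    refine ⟨hb, le_antisymm (dualFunction_le_primalValue hP R hl.le) ?_⟩
    calc (primalValue P k d R : EReal) ≤ latentEntropy P κ :=
          EReal.coe_ennreal_le_coe_ennreal_iff.2 (iInf₂_le κ hR.ge)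
      _ = lagrangian P R b⁻¹ κ := h2.symm
      _ ≤ dualFunction P k d R b⁻¹ := le_iInf h1
  exact ⟨R, hR.symm, (isPrimalSolution_iff_of_isTradeoff hP ht κ).2 ⟨h, hR.symm⟩, ht⟩

/-! ### First-order condition and exponential frontiers -/

lemma isTradeoff_iff_of_hasDerivAt {R : ℝ≥0} {D : ℝ} (hR : 0 < R)
    (hD : HasDerivAt (efficiencyFrontier P k d) D R) {b : ℝ} (hb : 0 < b) :
    IsTradeoff P k d R b ↔ D = b⁻¹ := by
  rw [isTradeoff_iff hP, and_iff_right hb, supergradient_iff_of_hasDerivAt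
    (concaveOn_efficiencyFrontier hP) (NNReal.coe_pos.2 hR) hD]

omit hP in
lemma hasDerivAt_expFrontier (Imax a r : ℝ) :
    HasDerivAt (expFrontier Imax a) (Imax * a * Real.exp (-(a * r))) r := by
  have h : HasDerivAt (expFrontier Imax a)
      (Imax * -(Real.exp (-(a * r)) * -(a * 1))) r :=
    ((((hasDerivAt_id r).const_mul a).neg.exp).const_sub 1).const_mul Imax
  convert h using 1
  ring

/-- The least trade-off parameter of a frontier that is exponential to the left of the capacity. -/
lemma isLeast_isTradeoff_of_expFrontier {R : ℝ≥0} {Imax a : ℝ} (hR : 0 < R) (hI : 0 < Imax)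
    (ha : 0 < a)
    (h : ∀ᶠ r in 𝓝[≤] (R : ℝ), efficiencyFrontier P k d r = expFrontier Imax a r) :
    IsLeast {b | IsTradeoff P k d R b} (Real.exp (a * R) / (Imax * a)) := by
  have hR' : (0 : ℝ) < R := NNReal.coe_pos.2 hR
  -- The filter `𝓝[≤] R` includes `R` itself, so the values agree there and the left derivative is
  -- that of the model.
  have hL : HasDerivWithinAt (efficiencyFrontier P k d) (Imax * a * Real.exp (-(a * R)))
      (Set.Iio R) R :=
    ((hasDerivAt_expFrontier Imax a R).hasDerivWithinAt.congr_of_eventuallyEq h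
      (h.self_of_nhdsWithin Set.self_mem_Iic)).mono Set.Iio_subset_Iic_self
  have hinv : (Real.exp (a * R) / (Imax * a))⁻¹ = Imax * a * Real.exp (-(a * R)) := by
    rw [inv_div, Real.exp_neg, div_eq_mul_inv]
  constructor
  · rw [Set.mem_ofPred_eq, isTradeoff_iff hP, hinv]
    exact ⟨by positivity, supergradient_of_hasDerivWithinAt_Iio
      (concaveOn_efficiencyFrontier hP) hR' hL⟩
  · intro b hb
    rw [Set.mem_ofPred_eq, isTradeoff_iff hP] at hb
    have h1 := le_of_supergradient_of_hasDerivWithinAt_Iio hR' hL hb.2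
    rw [← hinv] at h1
    -- Inversion reverses order: the largest supergradient yields the least trade-off parameter.
    exact (inv_le_inv₀ hb.1 (by positivity)).1 h1

lemma isTradeoff_iff_of_expFrontier {R : ℝ≥0} {Imax a : ℝ} (hR : 0 < R) (hI : 0 < Imax)
    (ha : 0 < a)
    (h : ∀ᶠ r in 𝓝 (R : ℝ), efficiencyFrontier P k d r = expFrontier Imax a r) (b : ℝ) :
    IsTradeoff P k d R b ↔ b = Real.exp (a * R) / (Imax * a) := by
  have hmin := isLeast_isTradeoff_of_expFrontier hP hR hI ha (h.filter_mono nhdsWithin_le_nhds)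
  refine ⟨fun hb => ?_, fun hb => hb ▸ hmin.1⟩
  have hD := (hasDerivAt_expFrontier Imax a R).congr_of_eventuallyEq h
  have h1 := (isTradeoff_iff_of_hasDerivAt hP hR hD hb.1).1 hb
  have h2 := (isTradeoff_iff_of_hasDerivAt hP hR hD hmin.1.1).1 hmin.1
  exact inv_injective (h1.symm.trans h2)

/-- Here `a * R = 1`, which produces the factor `e`. The difference is exactly `e * C₀ / (C₂ * (M -
k))`, so the bound holds with equality. -/
lemma exists_isLeast_isTradeoff_of_linear {R : ℝ≥0} {C₀ C₁ C₂ : ℝ} (hkM : k < M)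
    (hC₂ : 0 < C₂) (hR : 0 < R) (hRk : (R : ℝ) = C₁ * k + C₀)
    (h : ∀ᶠ r in 𝓝[≤] (R : ℝ), efficiencyFrontier P k d r =
      expFrontier (C₂ * ((M : ℝ) - k)) (1 / (C₁ * k + C₀)) r) :
    ∃ b, IsLeast {b | IsTradeoff P k d R b} b ∧
      b = Real.exp 1 * (C₁ * k + C₀) / (C₂ * ((M : ℝ) - k)) ∧
      |b - Real.exp 1 * C₁ / C₂ * (k / ((M : ℝ) - k))| ≤
        (Real.exp 1 * |C₀| / C₂) / ((M : ℝ) - k) := by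
  have hR' : (0 : ℝ) < C₁ * k + C₀ := hRk ▸ NNReal.coe_pos.2 hR
  have hMk : (0 : ℝ) < (M : ℝ) - k := sub_pos.2 (Nat.cast_lt.2 hkM)
  have hmin := isLeast_isTradeoff_of_expFrontier hP hR (mul_pos hC₂ hMk)
    (one_div_pos.2 hR') h
  have hb : Real.exp (1 / (C₁ * k + C₀) * R) / (C₂ * ((M : ℝ) - k) * (1 / (C₁ * k + C₀))) =
      Real.exp 1 * (C₁ * k + C₀) / (C₂ * ((M : ℝ) - k)) := by
    rw [hRk, one_div_mul_cancel hR'.ne']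
    field_simp
  refine ⟨_, hb ▸ hmin, rfl, le_of_eq ?_⟩
  have h1 : Real.exp 1 * (C₁ * k + C₀) / (C₂ * ((M : ℝ) - k)) -
      Real.exp 1 * C₁ / C₂ * (k / ((M : ℝ) - k)) = Real.exp 1 * C₀ / C₂ / ((M : ℝ) - k) := by
    field_simp
    ring
  rw [h1, abs_div, abs_div, abs_mul, abs_of_pos hMk, abs_of_pos hC₂, Real.abs_exp]

end Solutions

/-- Asymptotics of the least trade-off parameter for exponential frontiers. -/
lemma isEquivalent_exp_div {M k : ℕ → ℕ} {R : ℕ → ℝ} {Imax a : ℕ → ℝ} {C₀ C₁ C₂ : ℝ}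
    (hC₁ : 0 < C₁) (hk : Tendsto k atTop atTop) (ha : ∀ n, 0 < a n)
    (hI : Imax ~[atTop] fun n => C₂ * ((M n : ℝ) - k n))
    (haE : a ~[atTop] fun n => 1 / (C₁ * k n + C₀)) (hR : R ~[atTop] fun n => 1 / a n) :
    (fun n => Real.exp (a n * R n) / (Imax n * a n)) ~[atTop]
      fun n => Real.exp 1 * C₁ / C₂ * (k n / ((M n : ℝ) - k n)) := by
  have h1 : Tendsto (fun n => a n * R n) atTop (𝓝 1) := by
    have h : (fun n => a n * R n) ~[atTop] fun _ => (1 : ℝ) := by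
      refine ((IsEquivalent.refl (u := a)).mul hR).trans (IsEquivalent.refl.congr_right ?_)
      exact Eventually.of_forall fun n => mul_one_div_cancel (ha n).ne'
    exact (isEquivalent_const_iff_tendsto one_ne_zero).1 h
  have h2 : (fun n => Real.exp (a n * R n)) ~[atTop] fun _ => Real.exp 1 :=
    (isEquivalent_const_iff_tendsto (Real.exp_ne_zero 1)).2
      ((Real.continuous_exp.tendsto 1).comp h1)
  have hk' : Tendsto (fun n => C₁ * (k n : ℝ)) atTop atTop :=
    (tendsto_natCast_atTop_atTop.comp hk).const_mul_atTop hC₁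
  -- The offset `C₀` is negligible because `C₁ * k n` tends to infinity.
  have h3 : (fun n => C₁ * (k n : ℝ) + C₀) ~[atTop] fun n => C₁ * (k n : ℝ) :=
    IsEquivalent.refl.add_isLittleO
      (isLittleO_const_left.2 (Or.inr (tendsto_norm_atTop_atTop.comp hk')))
  have h4 : a ~[atTop] fun n => 1 / (C₁ * (k n : ℝ)) :=
    haE.trans (IsEquivalent.refl.div h3)
  refine (h2.div (hI.mul h4)).congr_right ?_
  refine Eventually.of_forall fun n => ?_
  simp only [Pi.div_apply, Pi.mul_apply]
  -- When `M n = k n`, both sides are zero under the convention for division by zero.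
  by_cases hMk : (M n : ℝ) - k n = 0
  · simp [hMk]
  · field_simp

end CoconutCIB

theorem mainTheorem6 {𝒳 𝒯 Θ : Type*} [MeasurableSpace 𝒳] [MeasurableSpace 𝒯] [Countable 𝒯]
    [MeasurableSingletonClass 𝒯] [Nonempty 𝒯] (d : ℕ) :
    (∀ (M k : ℕ) (_ : k ≤ M) (P : Measure (𝒳 × (Fin M → 𝒯))) [IsProbabilityMeasure P],
      futureEntropy P k ≠ ⊤ →
      -- (1) the Coconut loss and the conditional entropy of the suffix
      ((∀ κ : Encoder 𝒳 𝒯 M k d, latentEntropy P κ + infoFuture P κ = futureEntropy P k) ∧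
        (∀ (κ : Encoder 𝒳 𝒯 M k d) (q : Decoder 𝒳 𝒯 M k d),
          latentEntropy P κ ≤ loss P κ q ∧
          (loss P κ q = latentEntropy P κ ↔ IsPosterior P κ q)) ∧
        (∀ (enc : Θ → Encoder 𝒳 𝒯 M k d) (dec : Θ → Decoder 𝒳 𝒯 M k d) (R : ℝ≥0∞),
          WellSpecified P enc dec R →
          (⨅ θ, ⨅ _ : infoPast P (enc θ) ≤ R, loss P (enc θ) (dec θ)) = primalValue P k d R ∧
          (∀ θ, IsLossSolution P enc dec R θ ↔
            IsPrimalSolution P R (enc θ) ∧ IsPosterior P (enc θ) (dec θ)) ∧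
          (∀ κ, IsPrimalSolution P R κ ↔ ∃ θ, enc θ = κ ∧ IsLossSolution P enc dec R θ))) ∧
      -- (2) the Lagrange dual is the CIB problem
      (∀ R : ℝ≥0,
        (∀ l : ℝ, 0 < l →
          (∀ κ : Encoder 𝒳 𝒯 M k d, lagrangian P R l κ =
            (l : EReal) * cibObjective P l⁻¹ κ +
              ((futureEntropy P k : EReal) - ((l * R : ℝ) : EReal))) ∧
          dualFunction P k d R l =
            (l : EReal) * (⨅ κ : Encoder 𝒳 𝒯 M k d, cibObjective P l⁻¹ κ) +
              ((futureEntropy P k : EReal) - ((l * R : ℝ) : EReal)) ∧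
          (∀ κ : Encoder 𝒳 𝒯 M k d,
            (∀ κ' : Encoder 𝒳 𝒯 M k d, lagrangian P R l κ ≤ lagrangian P R l κ') ↔
              IsCIBSolution P l⁻¹ κ)) ∧
        IsGreatest (dualFunction P k d R '' Set.Ici 0) (primalValue P k d R : EReal) ∧
        ((⨅ κ : Encoder 𝒳 𝒯 M k d, latentEntropy P κ) < primalValue P k d R →
          ∃ b, IsTradeoff P k d R b) ∧
        (∀ b, IsTradeoff P k d R b → ∀ κ : Encoder 𝒳 𝒯 M k d,
          IsPrimalSolution P R κ ↔ IsCIBSolution P b κ ∧ infoPast P κ = R)) ∧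
      (∀ (b : ℝ) (κ : Encoder 𝒳 𝒯 M k d), 0 < b → IsCIBSolution P b κ →
        ∃ R : ℝ≥0, infoPast P κ = R ∧ IsPrimalSolution P R κ ∧ IsTradeoff P k d R b) ∧
      -- (3) the trade-off parameter is the inverse slope of the efficiency frontier
      (∀ (R : ℝ≥0) (D : ℝ), 0 < R → HasDerivAt (efficiencyFrontier P k d) D R →
        ∀ b : ℝ, 0 < b → (IsTradeoff P k d R b ↔ D = b⁻¹)) ∧
      -- (4) its value for an exponential frontier
      (∀ (R : ℝ≥0) (Imax a : ℝ), 0 < R → 0 < Imax → 0 < a →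
        (∀ᶠ r in 𝓝[≤] (R : ℝ), efficiencyFrontier P k d r = expFrontier Imax a r) →
        IsLeast {b | IsTradeoff P k d R b} (Real.exp (a * R) / (Imax * a)) ∧
        ((∀ᶠ r in 𝓝 (R : ℝ), efficiencyFrontier P k d r = expFrontier Imax a r) →
          ∀ b, IsTradeoff P k d R b ↔ b = Real.exp (a * R) / (Imax * a))) ∧
      (∀ (R : ℝ≥0) (C₀ C₁ C₂ : ℝ), k < M → 0 < C₁ → 0 < C₂ → 0 < R → (R : ℝ) = C₁ * k + C₀ →
        (∀ᶠ r in 𝓝[≤] (R : ℝ),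
          efficiencyFrontier P k d r = expFrontier (C₂ * ((M : ℝ) - k)) (1 / (C₁ * k + C₀)) r) →
        ∃ b, IsLeast {b | IsTradeoff P k d R b} b ∧
          b = Real.exp 1 * (C₁ * k + C₀) / (C₂ * ((M : ℝ) - k)) ∧
          |b - Real.exp 1 * C₁ / C₂ * (k / ((M : ℝ) - k))| ≤
            (Real.exp 1 * |C₀| / C₂) / ((M : ℝ) - k))) ∧
    -- (5) asymptotics of the trade-off parameter along sequences of stages
    (∀ (M k : ℕ → ℕ) (P : ∀ n, Measure (𝒳 × (Fin (M n) → 𝒯))) [∀ n, IsProbabilityMeasure (P n)]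
      (R : ℕ → ℝ≥0) (Imax a b : ℕ → ℝ) (C₀ C₁ C₂ : ℝ),
      0 < C₁ → 0 < C₂ → (∀ n, k n < M n) → Tendsto k atTop atTop →
      (∀ n, futureEntropy (P n) (k n) ≠ ⊤) →
      (∀ n, 0 < R n ∧ 0 < Imax n ∧ 0 < a n) →
      Imax ~[atTop] (fun n => C₂ * ((M n : ℝ) - k n)) →
      a ~[atTop] (fun n => 1 / (C₁ * k n + C₀)) →
      (fun n => (R n : ℝ)) ~[atTop] (fun n => 1 / a n) →
      (∀ n, ∀ᶠ r in 𝓝[≤] (R n : ℝ),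
        efficiencyFrontier (P n) (k n) d r = expFrontier (Imax n) (a n) r) →
      (∀ n, IsLeast {b | IsTradeoff (P n) (k n) d (R n) b} (b n)) →
      b ~[atTop] (fun n => Real.exp 1 * C₁ / C₂ * (k n / ((M n : ℝ) - k n)))) := by
  refine ⟨fun M k _ P _ hP => ⟨⟨latentEntropy_add_infoFuture P, fun κ q =>
      ⟨latentEntropy_le_loss P κ q, loss_eq_latentEntropy_iff P hP κ q⟩, fun enc dec R hw =>
      ⟨iInf_loss_eq_primalValue hP hw, isLossSolution_iff hP hw,
        isPrimalSolution_iff_exists_isLossSolution hP hw⟩⟩, fun R => ⟨fun l hl => ⟨fun κ => ?_, ?_,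
      forall_lagrangian_le_iff hP R hl⟩, ⟨?_, ?_⟩, exists_isTradeoff_of_lt hP R,
      fun b hb κ => isPrimalSolution_iff_of_isTradeoff hP hb κ⟩,
    fun b κ hb h => exists_isTradeoff_of_isCIBSolution hP hb h,
    fun R D hR hD b hb => isTradeoff_iff_of_hasDerivAt hP hR hD hb,
    fun R Imax a hR hI ha h => ⟨isLeast_isTradeoff_of_expFrontier hP hR hI ha h,
      isTradeoff_iff_of_expFrontier hP hR hI ha⟩,
    fun R C₀ C₁ C₂ hkM _ hC₂ hR hRk h =>
      exists_isLeast_isTradeoff_of_linear hP hkM hC₂ hR hRk h⟩, ?_⟩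
  · rw [coe_futureEntropy_sub hP]
    exact lagrangian_eq_cibObjective hP R hl κ
  · rw [coe_futureEntropy_sub hP]
    exact dualFunction_eq_iInf_cibObjective hP d R hl
  · exact exists_dualFunction_eq_primalValue hP d R
  · rintro _ ⟨l, hl, rfl⟩
    exact dualFunction_le_primalValue hP R hl
  · intro M k P _ R Imax a b C₀ C₁ C₂ hC₁ _ _ hk hP hpos hI ha hR hF hb
    -- Least elements are unique, so `b` is the explicit sequence.
    have hbn : b = fun n => Real.exp (a n * R n) / (Imax n * a n) := funext fun n =>
      (hb n).unique (isLeast_isTradeoff_of_expFrontier (hP n) (hpos n).1 (hpos n).2.1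
        (hpos n).2.2 (hF n))
    rw [hbn]
    exact isEquivalent_exp_div hC₁ hk (fun n => (hpos n).2.2) hI ha hR
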